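/- Let $l>0$ and let $m\ge 1$ be an integer. For an interval $(a,b)$ let $H^m(a,b)$ be the space of real functions in $L^2(a,b)$ whose weak derivatives $f^{(j)}$, $0\le j\le m$, lie in $L^2(a,b)$, with norm $\|f\|_{H^m(a,b)}=\big(\sum_{j=0}^m\|f^{(j)}\|_{L^2(a,b)}^2\big)^{1/2}$. For integers $k\ge 1$, $1\le n\le 2^{k-1}$ and $i\ge 0$, put $J_{k,n}=\big(\tfrac{n-1}{2^{k-1}}l,\tfrac{n}{2^{k-1}}l\big)$ and define the Legendre wavelets on $[0,l)$ by $$\psi_{n,i}(x)=2^{k/2}\sqrt{\tfrac{2i+1}{2l}}\;P_i\!\left(\tfrac{2^k}{l}x-2n+1\right)\ \text{ if } \tfrac{n-1}{2^{k-1}}l\le x<\tfrac{n}{2^{k-1}}l,\qquad \psi_{n,i}(x)=0\ \text{ otherwise},$$ where $P_i$ is the Legendre polynomial of degree $i$ on $[-1,1]$ with $P_i(1)=1$. For $f\in L^2(0,l)$ and $M\ge 1$ let $$\Psi_{k,M-1}(f)=\sum_{n=1}^{2^{k-1}}\sum_{i=0}^{M-1}a_{n,i}\,\psi_{n,i},\qquad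 a_{n,i}=\int_0^l f(x)\psi_{n,i}(x)\,dx,$$ and for $f\in H^m(0,l)$ and $0\le r\le m$ let $$|f|_{H^{r,m,M-1,k}(0,l)}=\Big(\sum_{j=\min\{m,M\}}^m (2^k)^{2r-2j}\,\|f^{(j)}\|_{L^2(0,l)}^2\Big)^{1/2}.$$ Then there is a constant $C>0$, depending only on $l$ and $m$, such that for all $f\in H^m(0,l)$ and all integers $M\ge 2$ and $k\ge 1$, $$\|f-\Psi_{k,M-1}(f)\|_{L^2(0,l)}\le C\,(M-1)^{-m}\,|f|_{H^{0,m,M-1,k}(0,l)},$$ and, for every integer $r$ with $1\le r\le m$, the function $f-\Psi_{k,M-1}(f)$ belongs to $H^r(J_{k,n})$ for each $n$ and $$\Big(\sum_{n=1}^{2^{k-1}}\|f-\Psi_{k,M-1}(f)\|_{H^r(J_{k,n})}^2\Big)^{1/2}\le C\,(M-1)^{2r-\frac12-m}\,|f|_{H^{r,m,M-1,k}(0,l)}.$$ -/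

import Mathlib

open MeasureTheory Set

open scoped ContDiff

noncomputable section

namespace LegendreWavelet

/-- `g` is a weak derivative of order `j` of `f` on the open interval `(a, b)`: both functions are
locally integrable on `(a, b)`, and integration by parts holds against every test function
`φ ∈ C_c^∞(a, b)`. -/
def HasWeakDeriv (a b : ℝ) (j : ℕ) (f g : ℝ → ℝ) : Prop :=
  LocallyIntegrableOn f (Ioo a b) ∧ LocallyIntegrableOn g (Ioo a b) ∧
    ∀ φ : ℝ → ℝ, ContDiff ℝ ∞ φ → HasCompactSupport φ → tsupport φ ⊆ Ioo a b →
      ∫ x in Ioo a b, f x * iteratedDeriv j φ x = (-1) ^ j * ∫ x in Ioo a b, g x * φ x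

/-- The Sobolev space `H^m(a, b)`: the functions in `L²(a, b)` that have weak derivatives in
`L²(a, b)` of all orders up to `m`. -/
def MemH (a b : ℝ) (m : ℕ) (f : ℝ → ℝ) : Prop :=
  MemLp f 2 (volume.restrict (Ioo a b)) ∧
    ∀ j ≤ m, ∃ g : ℝ → ℝ, MemLp g 2 (volume.restrict (Ioo a b)) ∧ HasWeakDeriv a b j f g

open Classical in
/-- The weak derivative `f^{(j)}` on `(a, b)` (unique almost everywhere on `(a, b)`), with the
default value `0` if `f` has none. -/
def weakDeriv (a b : ℝ) (j : ℕ) (f : ℝ → ℝ) : ℝ → ℝ :=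
  if h : ∃ g : ℝ → ℝ, HasWeakDeriv a b j f g then h.choose else 0

/-- The norm of `L²(a, b)`, for functions in `L²(a, b)`. -/
def normL2 (a b : ℝ) (f : ℝ → ℝ) : ℝ :=
  Real.sqrt (∫ x in Ioo a b, f x ^ 2)

/-- The norm of `H^m(a, b)`, for functions in `H^m(a, b)`. -/
def normH (a b : ℝ) (m : ℕ) (f : ℝ → ℝ) : ℝ :=
  Real.sqrt (∑ j ∈ Finset.range (m + 1), normL2 a b (weakDeriv a b j f) ^ 2)

/-- The Legendre polynomial `P_m` on `[-1, 1]`, normalized by `P_m(1) = 1`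
(Rodrigues' formula). -/
def legendre (m : ℕ) : Polynomial ℝ :=
  Polynomial.C (1 / (2 ^ m * (m.factorial : ℝ))) *
    Polynomial.derivative^[m] ((Polynomial.X ^ 2 - 1) ^ m)

/-- The mesh point `n l / 2^{k-1}` (for `k ≥ 1`). -/
def node (l : ℝ) (k n : ℕ) : ℝ := (n : ℝ) / 2 ^ (k - 1) * l

/-- The Legendre wavelet `ψ_{n,i}` of level `k ≥ 1` on `[0, l)`, for `1 ≤ n ≤ 2^{k-1}`. -/
def wavelet (l : ℝ) (k n i : ℕ) (x : ℝ) : ℝ :=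
  (Ico (node l k (n - 1)) (node l k n)).indicator
    (fun x => (2 : ℝ) ^ ((k : ℝ) / 2) * Real.sqrt ((2 * (i : ℝ) + 1) / (2 * l)) *
      (legendre i).eval ((2 : ℝ) ^ k / l * x - 2 * n + 1)) x

/-- The wavelet coefficient `a_{n,i} = ⟨f, ψ_{n,i}⟩` in `L²(0, l)`. -/
def coeff (l : ℝ) (k : ℕ) (f : ℝ → ℝ) (n i : ℕ) : ℝ :=
  ∫ x in Ioo 0 l, f x * wavelet l k n i x

/-- The truncated Legendre wavelet expansion `Ψ_{k,M-1}(f)`. -/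
def Psi (l : ℝ) (k M : ℕ) (f : ℝ → ℝ) (x : ℝ) : ℝ :=
  ∑ n ∈ Finset.Icc 1 (2 ^ (k - 1)), ∑ i ∈ Finset.range M, coeff l k f n i * wavelet l k n i x

/-- Membership in the piecewise Sobolev space: the restriction of `g` to each mesh interval
`J_{k,n} = ((n-1) l / 2^{k-1}, n l / 2^{k-1})` belongs to `H^r(J_{k,n})`. -/
def MemBrokenH (l : ℝ) (k r : ℕ) (g : ℝ → ℝ) : Prop :=
  ∀ n ∈ Finset.Icc 1 (2 ^ (k - 1)), MemH (node l k (n - 1)) (node l k n) r g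

/-- The `H^r(0, l)` norm of a function that is piecewise in `H^r`, with derivatives taken on each
mesh interval: the square root of `∑_n ‖g‖²_{H^r(J_{k,n})}`. -/
def brokenNormH (l : ℝ) (k r : ℕ) (g : ℝ → ℝ) : ℝ :=
  Real.sqrt (∑ n ∈ Finset.Icc 1 (2 ^ (k - 1)), normH (node l k (n - 1)) (node l k n) r g ^ 2)

/-- The seminorm `|f|_{H^{r,m,M-1,k}(0,l)}`. -/
def seminormH (l : ℝ) (r m M k : ℕ) (f : ℝ → ℝ) : ℝ :=
  Real.sqrt (∑ j ∈ Finset.Icc (min m M) m,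
    ((2 : ℝ) ^ k) ^ (2 * (r : ℤ) - 2 * (j : ℤ)) * normL2 0 l (weakDeriv 0 l j f) ^ 2)

end LegendreWavelet

end

noncomputable section

namespace LegendreWavelet

open Polynomial Filter Topology

/-! ### Legendre polynomials -/

/-! On each mesh interval the wavelets are rescaled orthonormal Legendre polynomials, so the
truncated expansion is there the `L²`-orthogonal projection onto polynomials of degree less than `M`
(`Psi_eq`). After an affine change of variables everything reduces to estimates for the Legendre
projection on `(-1, 1)`, uniform in `M`, which are then scaled back and summed over the cells.

For the `L²` error, Parseval turns the error into the tail of the squared Legendre moments. Testing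
`v = u'` against `P_{i+2} - P_i`, which vanishes at `±1` and has derivative `(2i+3) P_{i+1}`,
expresses a moment of `u` as a difference of two moments of `v` divided by `2i+3` (`moment_succ`).
Hence each derivative gains a factor of order `1/M` and lowers `M` by one (`projError_succ_le`). The
descent stops when derivatives or degrees run out, whence `min m M`.

For derivatives of the error, projection does not commute with differentiation, but the commutator
is only a combination of `P_M'` and `P_{M-1}'` whose coefficients are two moments of `v`
(`derivative_proj_succ`). Those moments are at most a multiple of `M^{-1/2}` times the projection
error of `v`, and `‖P_i^{(s)}‖` is at most `(i+1)^{2s-1}`. Induction on `s` gives the exponent `2s -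
1/2 - m` for `s ≥ 1`.

On a cell of half-length `h = l / 2^k` an estimate of the `s`-th derivative by the `j`-th one scales
by `h^{2(j-s)}` in squares. Since `2^k ≥ 1` and `s ≤ r`, this is dominated by the weight
`(2^k)^{2r-2j}` up to a constant in `l` and `m` (`cellHalf_sq_pow_le`). -/

@[simp]
lemma legendre_zero : legendre 0 = 1 := by simp [legendre]

@[simp]
lemma legendre_one : legendre 1 = X := by
  simp [legendre, derivative_pow]
  rw [← mul_assoc, ← C_mul]
  norm_num

lemma derivative_X_sq_sub_one_pow_succ (i : ℕ) :
    derivative ((X ^ 2 - 1 : ℝ[X]) ^ (i + 1)) = C (2 * (i + 1 : ℝ)) * ((X ^ 2 - 1) ^ i * X) := by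
  rw [derivative_pow_succ]
  simp only [derivative_sub, derivative_X_pow, derivative_one, C_mul, C_add, C_1, map_natCast]
  simp [C_ofNat]
  ring

lemma legendre_succ_eq (i : ℕ) :
    legendre (i + 1) =
      C (1 / (2 ^ i * (i.factorial : ℝ))) * derivative^[i] ((X ^ 2 - 1) ^ i * X) := by
  rw [legendre, Function.iterate_succ_apply, derivative_X_sq_sub_one_pow_succ,
    iterate_derivative_C_mul, ← mul_assoc, ← C_mul]
  congr 2
  rw [Nat.factorial_succ]
  push_cast
  field_simp
  ring

/-- Differentiating `(X² - 1)^{i+1} X` and writing `X² = (X² - 1) + 1` leaves two powers of `X² -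
1`, which Rodrigues' formula turns into `P_{i+1}` and `P_i'`. All later moment and norm recurrences
come from this identity. -/
lemma derivative_legendre_add_two (i : ℕ) :
    derivative (legendre (i + 2)) =
      C (2 * (i : ℝ) + 3) * legendre (i + 1) + derivative (legendre i) := by
  have key : derivative ((X ^ 2 - 1 : ℝ[X]) ^ (i + 1) * X) =
      C (2 * (i : ℝ) + 3) * (X ^ 2 - 1) ^ (i + 1) +
        C (2 * (i + 1 : ℝ)) * (X ^ 2 - 1) ^ i := by
    rw [derivative_mul, derivative_X_sq_sub_one_pow_succ, derivative_X]
    simp only [C_mul, C_add, map_natCast, C_1, C_ofNat]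
    ring
  rw [legendre_succ_eq, derivative_C_mul, ← Function.iterate_succ_apply' derivative,
    Function.iterate_succ_apply, key, iterate_map_add, iterate_derivative_C_mul,
    iterate_derivative_C_mul, mul_add]
  congr 1
  · rw [legendre]; ring
  · rw [legendre, derivative_C_mul, ← Function.iterate_succ_apply' derivative, ← mul_assoc,
      ← C_mul]
    congr 2
    rw [Nat.factorial_succ]
    push_cast
    field_simp
    ring

lemma eval_iterate_derivative_X_sq_sub_one_pow {i j : ℕ} (h : j < i) {x : ℝ} (hx : x ^ 2 = 1) :
    (derivative^[j] ((X ^ 2 - 1 : ℝ[X]) ^ i)).eval x = 0 := by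
  obtain ⟨q, hq⟩ := pow_sub_dvd_iterate_derivative_pow (X ^ 2 - 1 : ℝ[X]) i j
  rw [hq, eval_mul, eval_pow]
  simp [hx, Nat.sub_ne_zero_of_lt h]

/-- Leibniz applied to `(X² - 1)^i X` leaves one extra term, with fewer than `i` derivatives of `(X²
- 1)^i`; it vanishes at `±1`. -/
lemma eval_legendre_succ (i : ℕ) {x : ℝ} (hx : x ^ 2 = 1) :
    (legendre (i + 1)).eval x = x * (legendre i).eval x := by
  rw [legendre_succ_eq, iterate_derivative_mul_X, legendre]
  rcases i with _ | i
  · simp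
  · simp only [eval_mul, eval_add, eval_C, eval_X, nsmul_eq_mul, eval_natCast]
    rw [Nat.add_sub_cancel, eval_iterate_derivative_X_sq_sub_one_pow (Nat.lt_succ_self i) hx]
    ring

lemma eval_legendre_add_two (i : ℕ) {x : ℝ} (hx : x ^ 2 = 1) :
    (legendre (i + 2)).eval x = (legendre i).eval x := by
  rw [eval_legendre_succ _ hx, eval_legendre_succ _ hx, ← mul_assoc, ← sq, hx, one_mul]

@[simp]
lemma eval_one_legendre (i : ℕ) : (legendre i).eval 1 = 1 := by
  induction i with
  | zero => simp
  | succ i ih => rw [eval_legendre_succ _ (by norm_num), ih, one_mul]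

@[simp]
lemma eval_neg_one_legendre (i : ℕ) : (legendre i).eval (-1) = (-1) ^ i := by
  induction i with
  | zero => simp
  | succ i ih => rw [eval_legendre_succ _ (by norm_num), ih, pow_succ']

lemma natDegree_X_sq_sub_one_pow (i : ℕ) : ((X ^ 2 - 1 : ℝ[X]) ^ i).natDegree = 2 * i := by
  rw [natDegree_pow, show (1 : ℝ[X]) = C 1 by simp, natDegree_X_pow_sub_C, mul_comm]

lemma natDegree_legendre_le (i : ℕ) : (legendre i).natDegree ≤ i := by
  refine (natDegree_C_mul_le _ _).trans ((natDegree_iterate_derivative _ _).trans ?_)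
  rw [natDegree_X_sq_sub_one_pow]
  omega

lemma degree_legendre (i : ℕ) : (legendre i).degree = i := by
  have hm : ((X ^ 2 - 1 : ℝ[X]) ^ i).coeff (i + i) = 1 := by
    have h : ((X ^ 2 - 1 : ℝ[X]) ^ i).Monic :=
      (show (1 : ℝ[X]) = C 1 by simp) ▸ (monic_X_pow_sub_C (1 : ℝ) two_ne_zero).pow i
    have := h.coeff_natDegree
    rwa [natDegree_X_sq_sub_one_pow, two_mul] at this
  have hc : (legendre i).coeff i ≠ 0 := by
    rw [legendre, coeff_C_mul, coeff_iterate_derivative, hm, nsmul_eq_mul, mul_one]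
    have : 0 < (i + i).descFactorial i := Nat.descFactorial_pos.2 (Nat.le_add_left i i)
    positivity
  refine le_antisymm ?_ (le_degree_of_ne_zero hc)
  exact degree_le_of_natDegree_le (natDegree_legendre_le i)

lemma span_range_legendre : Submodule.span ℝ (Set.range legendre) = ⊤ := by
  let S : Polynomial.Sequence ℝ := ⟨legendre, degree_legendre⟩
  exact S.span fun i => (leadingCoeff_ne_zero.2 (S.ne_zero i)).isUnit

/-! ### Orthogonality -/

lemma integral_eval_mul_derivative (p q : ℝ[X]) (a b : ℝ) :
    ∫ x in a..b, p.eval x * (derivative q).eval x =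
      p.eval b * q.eval b - p.eval a * q.eval a - ∫ x in a..b, (derivative p).eval x * q.eval x :=
  intervalIntegral.integral_mul_deriv_eq_deriv_mul (fun x _ => p.hasDerivAt x)
    (fun x _ => q.hasDerivAt x) ((derivative p).continuous.intervalIntegrable _ _)
    ((derivative q).continuous.intervalIntegrable _ _)

lemma integral_iterate_derivative_mul (i : ℕ) (j : ℕ) (hj : j ≤ i) (q : ℝ[X]) :
    ∫ x in (-1 : ℝ)..1, q.eval x * (derivative^[j] ((X ^ 2 - 1 : ℝ[X]) ^ i)).eval x =
      (-1) ^ j * ∫ x in (-1 : ℝ)..1, (derivative^[j] q).eval x * ((X ^ 2 - 1 : ℝ[X]) ^ i).eval x := by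
  induction j generalizing q with
  | zero => simp
  | succ j ih =>
    rw [Function.iterate_succ_apply', integral_eval_mul_derivative,
      eval_iterate_derivative_X_sq_sub_one_pow hj (by norm_num),
      eval_iterate_derivative_X_sq_sub_one_pow hj (by norm_num), ih (by omega),
      Function.iterate_succ_apply]
    ring

lemma integral_mul_legendre_eq_zero {i : ℕ} {q : ℝ[X]} (hq : q.natDegree < i) :
    ∫ x in (-1 : ℝ)..1, q.eval x * (legendre i).eval x = 0 := by
  have h := integral_iterate_derivative_mul i i le_rfl q
  rw [iterate_derivative_eq_zero hq] at h
  simp only [eval_zero, zero_mul, intervalIntegral.integral_zero, mul_zero] at h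
  simp only [legendre, eval_mul, eval_C]
  simp_rw [mul_left_comm _ (1 / (2 ^ i * (i.factorial : ℝ)))]
  rw [intervalIntegral.integral_const_mul, h, mul_zero]

lemma integral_legendre_mul_legendre {i j : ℕ} (h : i ≠ j) :
    ∫ x in (-1 : ℝ)..1, (legendre i).eval x * (legendre j).eval x = 0 := by
  rcases lt_or_gt_of_ne h with h | h
  · exact integral_mul_legendre_eq_zero ((natDegree_legendre_le i).trans_lt h)
  · simp_rw [mul_comm ((legendre i).eval _)]
    exact integral_mul_legendre_eq_zero ((natDegree_legendre_le j).trans_lt h)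

lemma natDegree_derivative_legendre_succ_le (i : ℕ) :
    (derivative (legendre (i + 1))).natDegree ≤ i :=
  (natDegree_derivative_le _).trans (by have := natDegree_legendre_le (i + 1); omega)

lemma integral_legendre_sq (i : ℕ) :
    ∫ x in (-1 : ℝ)..1, (legendre i).eval x * (legendre i).eval x = 2 / (2 * i + 1) := by
  rcases i with _ | i
  · simp; norm_num
  have h := integral_eval_mul_derivative (legendre (i + 1)) (legendre (i + 2)) (-1) 1
  rw [integral_mul_legendre_eq_zero
    ((natDegree_derivative_legendre_succ_le i).trans_lt (by omega)), derivative_legendre_add_two]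
    at h
  simp only [eval_add, eval_mul, eval_C, mul_add] at h
  rw [intervalIntegral.integral_add (by apply Continuous.intervalIntegrable; fun_prop)
    (by apply Continuous.intervalIntegrable; fun_prop)] at h
  have h0 : ∫ x in (-1 : ℝ)..1, (legendre (i + 1)).eval x * (derivative (legendre i)).eval x = 0 := by
    simp_rw [mul_comm ((legendre (i + 1)).eval _)]
    apply integral_mul_legendre_eq_zero
    have := natDegree_derivative_le (legendre i)
    have := natDegree_legendre_le i
    omega
  simp_rw [mul_left_comm _ (2 * (i : ℝ) + 3)] at h
  rw [h0, intervalIntegral.integral_const_mul] at h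
  simp only [eval_one_legendre, eval_neg_one_legendre] at h
  -- Consecutive Legendre polynomials have opposite parity, so the boundary terms add up to `2`,
  -- which equals `(2i+3) ∫ P_{i+1}²`.
  have h1 : ((-1 : ℝ) ^ (i + 1)) * (-1) ^ (i + 2) = -1 := by
    rw [← pow_add]; exact Odd.neg_one_pow ⟨i + 1, by ring⟩
  rw [h1] at h
  push_cast
  rw [eq_div_iff (by positivity)]
  linarith

/-- The squared norm of the derivative of `P_i` is `i (i + 1)`. -/
lemma integral_derivative_legendre_sq (i : ℕ) :
    ∫ x in (-1 : ℝ)..1, (derivative (legendre i)).eval x ^ 2 = i * (i + 1) := by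
  induction i using Nat.twoStepInduction with
  | zero => simp
  | one => norm_num
  | more i ih _ =>
    have h0 : ∫ x in (-1 : ℝ)..1,
        (derivative (legendre i)).eval x * (legendre (i + 1)).eval x = 0 := by
      apply integral_mul_legendre_eq_zero
      have := natDegree_derivative_le (legendre i)
      have := natDegree_legendre_le i
      omega
    have h1 := integral_legendre_sq (i + 1)
    have e : ∀ x : ℝ, (derivative (legendre (i + 2))).eval x ^ 2 =
        (2 * (i : ℝ) + 3) ^ 2 * ((legendre (i + 1)).eval x * (legendre (i + 1)).eval x) +
        (2 * (2 * (i : ℝ) + 3)) * ((derivative (legendre i)).eval x * (legendre (i + 1)).eval x) +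
        (derivative (legendre i)).eval x ^ 2 := by
      intro x
      rw [derivative_legendre_add_two]
      simp only [eval_add, eval_mul, eval_C]
      ring
    simp_rw [e]
    rw [intervalIntegral.integral_add (by apply Continuous.intervalIntegrable; fun_prop)
      (by apply Continuous.intervalIntegrable; fun_prop),
      intervalIntegral.integral_add (by apply Continuous.intervalIntegrable; fun_prop)
      (by apply Continuous.intervalIntegrable; fun_prop), intervalIntegral.integral_const_mul,
      intervalIntegral.integral_const_mul, h0, h1, ih]
    push_cast
    field_simp
    ring

/-! ### The norm of `L²(a, b)` -/

lemma memLp_two_of_continuous {f : ℝ → ℝ} (hf : Continuous f) (a b : ℝ) :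
    MemLp f 2 (volume.restrict (Ioo a b)) := by
  obtain ⟨C, hC⟩ := isCompact_Icc.exists_bound_of_continuousOn (s := Icc a b) hf.continuousOn
  refine MemLp.of_bound hf.aestronglyMeasurable C ?_
  filter_upwards [ae_restrict_mem measurableSet_Ioo] with x hx
  exact hC x (Ioo_subset_Icc_self hx)

lemma memLp_two_eval (p : ℝ[X]) (a b : ℝ) :
    MemLp (fun x => p.eval x) 2 (volume.restrict (Ioo a b)) :=
  memLp_two_of_continuous p.continuous a b

lemma integrable_mul_of_memLp {a b : ℝ} {f g : ℝ → ℝ}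
    (hf : MemLp f 2 (volume.restrict (Ioo a b))) (hg : MemLp g 2 (volume.restrict (Ioo a b))) :
    Integrable (fun x => f x * g x) (volume.restrict (Ioo a b)) :=
  MemLp.integrable_mul hf hg

lemma setIntegral_Ioo_eq {a b : ℝ} (h : a ≤ b) (f : ℝ → ℝ) :
    ∫ x in Ioo a b, f x = ∫ x in a..b, f x := by
  rw [intervalIntegral.integral_of_le h, integral_Ioc_eq_integral_Ioo]

lemma normL2_nonneg (a b : ℝ) (f : ℝ → ℝ) : 0 ≤ normL2 a b f := Real.sqrt_nonneg _

lemma normL2_sq (a b : ℝ) (f : ℝ → ℝ) : normL2 a b f ^ 2 = ∫ x in Ioo a b, f x ^ 2 :=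
  Real.sq_sqrt (integral_nonneg fun _ => sq_nonneg _)

lemma inner_toLp {a b : ℝ} {f g : ℝ → ℝ} (hf : MemLp f 2 (volume.restrict (Ioo a b)))
    (hg : MemLp g 2 (volume.restrict (Ioo a b))) :
    inner ℝ (hf.toLp f) (hg.toLp g) = ∫ x in Ioo a b, f x * g x := by
  rw [L2.inner_def]
  refine integral_congr_ae ?_
  filter_upwards [hf.coeFn_toLp, hg.coeFn_toLp] with x h1 h2
  simp [h1, h2, mul_comm]

lemma normL2_eq_norm_toLp {a b : ℝ} {f : ℝ → ℝ} (hf : MemLp f 2 (volume.restrict (Ioo a b))) :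
    normL2 a b f = ‖hf.toLp f‖ := by
  rw [norm_eq_sqrt_real_inner, inner_toLp, normL2]
  simp only [sq]

lemma normL2_congr {a b : ℝ} {f g : ℝ → ℝ} (h : f =ᵐ[volume.restrict (Ioo a b)] g) :
    normL2 a b f = normL2 a b g := by
  rw [normL2, normL2]
  congr 1
  exact integral_congr_ae (h.fun_comp (· ^ 2))

lemma normL2_add_le {a b : ℝ} {f g : ℝ → ℝ} (hf : MemLp f 2 (volume.restrict (Ioo a b)))
    (hg : MemLp g 2 (volume.restrict (Ioo a b))) :
    normL2 a b (fun x => f x + g x) ≤ normL2 a b f + normL2 a b g := by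
  have h := normL2_eq_norm_toLp (hf.add hg)
  rw [MemLp.toLp_add hf hg] at h
  rw [normL2_eq_norm_toLp hf, normL2_eq_norm_toLp hg]
  exact h.trans_le (norm_add_le _ _)

lemma normL2_const_mul (a b c : ℝ) (f : ℝ → ℝ) :
    normL2 a b (fun x => c * f x) = |c| * normL2 a b f := by
  simp only [normL2, mul_pow, integral_const_mul]
  rw [Real.sqrt_mul (sq_nonneg c), Real.sqrt_sq_eq_abs]

/-- `‖P_i^{(s)}‖ ≤ (i + 1)^{2 s - 1}` for `s ≥ 1`. -/
lemma normL2_iterate_derivative_legendre_le (s i : ℕ) :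
    normL2 (-1) 1 (fun x => (derivative^[s + 1] (legendre i)).eval x) ≤ (i + 1 : ℝ) ^ (2 * s + 1) := by
  induction s generalizing i with
  | zero =>
    rw [normL2, setIntegral_Ioo_eq (by norm_num)]
    simp only [zero_add, Function.iterate_one, mul_zero, pow_one]
    rw [integral_derivative_legendre_sq, Real.sqrt_le_iff]
    constructor
    · positivity
    · nlinarith [(Nat.cast_nonneg i : (0 : ℝ) ≤ i)]
  | succ s ih =>
    induction i using Nat.twoStepInduction with
    | zero =>
      rw [legendre_zero, iterate_derivative_one (by omega)]
      simp [normL2]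
    | one =>
      rw [legendre_one, iterate_derivative_X (by omega)]
      simp only [eval_zero, normL2]
      simp
    | more i h _ =>
      rw [Function.iterate_succ_apply, derivative_legendre_add_two, iterate_map_add,
        iterate_derivative_C_mul, ← Function.iterate_succ_apply derivative]
      simp only [eval_add, eval_mul, eval_C]
      refine (normL2_add_le ((memLp_two_eval _ _ _).const_mul _) (memLp_two_eval _ _ _)).trans ?_
      rw [normL2_const_mul, abs_of_nonneg (by positivity)]
      have h1 := ih (i + 1)
      calc _ ≤ (2 * (i : ℝ) + 3) * (((i + 1 : ℕ) : ℝ) + 1) ^ (2 * s + 1) +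
            ((i : ℝ) + 1) ^ (2 * (s + 1) + 1) := by gcongr
        _ ≤ (2 * (i : ℝ) + 3) * ((i : ℝ) + 2) ^ (2 * s + 1) +
            ((i : ℝ) + 1) ^ 2 * ((i : ℝ) + 2) ^ (2 * s + 1) := by
          have e : ((i : ℝ) + 1) ^ (2 * (s + 1) + 1) =
            ((i : ℝ) + 1) ^ 2 * ((i : ℝ) + 1) ^ (2 * s + 1) := by ring
          have e' : ((i + 1 : ℕ) : ℝ) + 1 = (i : ℝ) + 2 := by push_cast; ring
          rw [e, e']
          gcongr
          norm_num
        -- The bound reproduces itself because `(2i + 3) + (i + 1)² = (i + 2)²`.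
        _ = ((i : ℝ) + 2) ^ (2 * (s + 1) + 1) := by ring
        _ ≤ _ := pow_le_pow_left₀ (by positivity) (by push_cast; linarith) _

/-! ### The Parseval identity for Legendre polynomials -/

/-- The `i`-th Legendre moment of `u`. -/
def moment (u : ℝ → ℝ) (i : ℕ) : ℝ := ∫ x in Ioo (-1) 1, u x * (legendre i).eval x

/-- The orthonormal Legendre polynomials in `L²(-1, 1)`. -/
def legendreLp (i : ℕ) : Lp ℝ 2 (volume.restrict (Ioo (-1 : ℝ) 1)) :=
  Real.sqrt ((2 * i + 1) / 2) • (memLp_two_eval (legendre i) (-1) 1).toLp _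

lemma orthonormal_legendreLp : Orthonormal ℝ legendreLp := by
  rw [orthonormal_iff_ite]
  intro i j
  simp only [legendreLp, inner_smul_left, inner_smul_right]
  rw [inner_toLp, setIntegral_Ioo_eq (by norm_num)]
  split_ifs with h
  · subst h
    have h0 : (0 : ℝ) ≤ (2 * i + 1) / 2 := by positivity
    rw [integral_legendre_sq, conj_trivial, ← mul_assoc, Real.mul_self_sqrt h0]
    field_simp
  · rw [integral_legendre_mul_legendre h]; simp

lemma integral_mul_eval_eq_zero {u : ℝ → ℝ} (hu : MemLp u 2 (volume.restrict (Ioo (-1 : ℝ) 1)))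
    (h : ∀ i, moment u i = 0) (p : ℝ[X]) : ∫ x in Ioo (-1 : ℝ) 1, u x * p.eval x = 0 := by
  have hp : p ∈ Submodule.span ℝ (Set.range legendre) := span_range_legendre ▸ Submodule.mem_top
  induction hp using Submodule.span_induction with
  | mem x hx => obtain ⟨i, rfl⟩ := hx; exact h i
  | zero => simp
  | add p q _ _ hp hq =>
    simp only [eval_add, mul_add]
    rw [integral_add (integrable_mul_of_memLp hu (memLp_two_eval p _ _))
      (integrable_mul_of_memLp hu (memLp_two_eval q _ _)), hp, hq, add_zero]
  | smul c p _ hp =>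
    simp only [eval_smul, smul_eq_mul, mul_left_comm _ c]
    rw [integral_const_mul, hp, mul_zero]

/-- A function in `L²(-1, 1)` with vanishing Legendre moments is zero. -/
lemma ae_eq_zero_of_moment_eq_zero {u : ℝ → ℝ}
    (hu : MemLp u 2 (volume.restrict (Ioo (-1 : ℝ) 1))) (h : ∀ i, moment u i = 0) :
    u =ᵐ[volume.restrict (Ioo (-1 : ℝ) 1)] 0 := by
  have hi : IntegrableOn u (Ioo (-1) 1) := hu.integrable one_le_two
  have key : ∀ g : ℝ → ℝ, Continuous g → ∫ x in Ioo (-1 : ℝ) 1, u x * g x = 0 := by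
    intro g hg
    have hug : Integrable (fun x => u x * g x) (volume.restrict (Ioo (-1 : ℝ) 1)) :=
      integrable_mul_of_memLp hu (memLp_two_of_continuous hg _ _)
    by_contra hne
    set K := ∫ x in Ioo (-1 : ℝ) 1, |u x| with hK
    have hK0 : 0 ≤ K := integral_nonneg fun _ => abs_nonneg _
    -- A polynomial within `ε` of `g` shows that the integral is at most `K ε`, whereas by this
    -- choice it equals `(K + 1) ε`.
    set ε := |∫ x in Ioo (-1 : ℝ) 1, u x * g x| / (K + 1) with hε
    have hε0 : 0 < ε := div_pos (abs_pos.2 hne) (by linarith)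
    obtain ⟨p, hp⟩ := exists_polynomial_near_of_continuousOn (-1) 1 g hg.continuousOn ε hε0
    have h1 : ∫ x in Ioo (-1 : ℝ) 1, u x * g x = ∫ x in Ioo (-1 : ℝ) 1, u x * (g x - p.eval x) := by
      simp only [mul_sub]
      rw [integral_sub hug (integrable_mul_of_memLp hu (memLp_two_eval p _ _)),
        integral_mul_eval_eq_zero hu h, sub_zero]
    have h2 : |∫ x in Ioo (-1 : ℝ) 1, u x * g x| ≤ K * ε := by
      rw [h1, hK, ← integral_mul_const]
      refine (abs_integral_le_integral_abs).trans ?_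
      refine setIntegral_mono_on ?_ (hi.abs.mul_const ε) measurableSet_Ioo ?_
      · exact (integrable_mul_of_memLp hu
          (memLp_two_of_continuous (hg.sub p.continuous) _ _)).abs
      · intro x hx
        rw [abs_mul]
        gcongr
        rw [abs_sub_comm]
        exact (hp x (Ioo_subset_Icc_self hx)).le
    have h3 : |∫ x in Ioo (-1 : ℝ) 1, u x * g x| = ε * (K + 1) := by
      rw [hε]; field_simp
    nlinarith
  have := isOpen_Ioo.ae_eq_zero_of_integral_contDiff_smul_eq_zero (μ := volume)
    (U := Ioo (-1 : ℝ) 1) (f := u) hi.locallyIntegrableOn (by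
      intro g hg _ hs
      rw [← key g hg.continuous, ← integral_indicator measurableSet_Ioo]
      congr 1 with x
      by_cases hx : x ∈ Ioo (-1 : ℝ) 1
      · simp [hx, mul_comm]
      · simp [hx, image_eq_zero_of_notMem_tsupport fun h' => hx (hs h')])
  rwa [Filter.EventuallyEq, ae_restrict_iff' measurableSet_Ioo]

lemma orthogonal_span_legendreLp : (Submodule.span ℝ (Set.range legendreLp))ᗮ = ⊥ := by
  rw [Submodule.eq_bot_iff]
  intro v hv
  rw [Submodule.mem_orthogonal] at hv
  have hv' : v = (Lp.memLp v).toLp v := (Lp.toLp_coeFn v _).symm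
  rw [Lp.eq_zero_iff_ae_eq_zero]
  refine ae_eq_zero_of_moment_eq_zero (Lp.memLp v) fun i => ?_
  have h := hv (legendreLp i) (Submodule.subset_span ⟨i, rfl⟩)
  rw [hv', legendreLp, inner_smul_left, inner_toLp, conj_trivial] at h
  have h0 : Real.sqrt ((2 * i + 1) / 2) ≠ 0 := (Real.sqrt_pos.2 (by positivity)).ne'
  simpa only [moment, mul_comm] using (mul_eq_zero.1 h).resolve_left h0

lemma hasSum_moment_sq {u : ℝ → ℝ} (hu : MemLp u 2 (volume.restrict (Ioo (-1 : ℝ) 1))) :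
    HasSum (fun i : ℕ => (2 * i + 1) / 2 * moment u i ^ 2) (normL2 (-1) 1 u ^ 2) := by
  have h := (HilbertBasis.mkOfOrthogonalEqBot orthonormal_legendreLp
    orthogonal_span_legendreLp).hasSum_inner_mul_inner (hu.toLp u) (hu.toLp u)
  rw [HilbertBasis.coe_mkOfOrthogonalEqBot, inner_toLp] at h
  rw [normL2_sq]
  simp only [sq (u _)]
  convert! h using 2 with i
  have h0 : (0 : ℝ) ≤ (2 * i + 1) / 2 := by positivity
  rw [real_inner_comm, legendreLp, inner_smul_left, inner_toLp, conj_trivial, ← sq, mul_pow,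
    Real.sq_sqrt h0]
  simp only [moment, mul_comm (u _)]

/-- The orthogonal projection of `u` onto the polynomials of degree less than `M`. -/
def proj (M : ℕ) (u : ℝ → ℝ) : ℝ[X] :=
  ∑ i ∈ Finset.range M, C ((2 * i + 1) / 2 * moment u i) * legendre i

@[simp]
lemma proj_zero (u : ℝ → ℝ) : proj 0 u = 0 := by simp [proj]

lemma proj_succ (M : ℕ) (u : ℝ → ℝ) :
    proj (M + 1) u = proj M u + C ((2 * M + 1) / 2 * moment u M) * legendre M := by
  simp [proj, Finset.sum_range_succ]

lemma moment_proj (M : ℕ) (u : ℝ → ℝ) (i : ℕ) :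
    moment (fun x => (proj M u).eval x) i = if i < M then moment u i else 0 := by
  have h : ∀ x, (proj M u).eval x * (legendre i).eval x = ∑ j ∈ Finset.range M,
      (2 * j + 1) / 2 * moment u j * ((legendre j).eval x * (legendre i).eval x) := by
    intro x
    simp only [proj, eval_finsetSum, eval_mul, eval_C, Finset.sum_mul, mul_assoc]
  rw [moment, setIntegral_Ioo_eq (by norm_num)]
  simp_rw [h]
  rw [intervalIntegral.integral_finsetSum fun j _ => by
    apply Continuous.intervalIntegrable; fun_prop]
  simp_rw [intervalIntegral.integral_const_mul]
  simp_rw [← Finset.mem_range]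
  rw [← Finset.sum_ite_eq (Finset.range M) i (moment u)]
  refine Finset.sum_congr rfl fun j _ => ?_
  split_ifs with hij
  · subst hij
    rw [integral_legendre_sq]
    field_simp
  · rw [integral_legendre_mul_legendre (Ne.symm hij), mul_zero]

/-- The error of the orthogonal projection onto the polynomials of degree less than `M`. -/
lemma hasSum_sub_proj {u : ℝ → ℝ} (hu : MemLp u 2 (volume.restrict (Ioo (-1 : ℝ) 1))) (M : ℕ) :
    HasSum (fun i : ℕ => (2 * (i + M : ℕ) + 1) / 2 * moment u (i + M) ^ 2)
      (normL2 (-1) 1 (fun x => u x - (proj M u).eval x) ^ 2) := by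
  have h := hasSum_moment_sq (hu.sub (memLp_two_eval (proj M u) _ _))
  have hm : ∀ i, moment (u - fun x => (proj M u).eval x) i =
      if i < M then 0 else moment u i := by
    intro i
    have h1 : moment (u - fun x => (proj M u).eval x) i =
        moment u i - moment (fun x => (proj M u).eval x) i := by
      simp only [moment, Pi.sub_apply, sub_mul]
      exact integral_sub (integrable_mul_of_memLp hu (memLp_two_eval _ _ _))
        (integrable_mul_of_memLp (memLp_two_eval _ _ _) (memLp_two_eval _ _ _))
    rw [h1, moment_proj]
    split_ifs <;> simp
  simp only [hm] at h
  rw [← hasSum_nat_add_iff' M, Finset.sum_eq_zero, sub_zero] at h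
  · simpa [Pi.sub_def] using h
  · intro i hi
    simp [Finset.mem_range.1 hi]

/-! ### Projection errors on the reference interval -/

/-- `v` is the derivative of `u` on `(a, b)`, tested against polynomials that vanish at the
endpoints. -/
def HasPolyWeakDeriv (a b : ℝ) (u v : ℝ → ℝ) : Prop :=
  ∀ Q : ℝ[X], Q.eval a = 0 → Q.eval b = 0 →
    ∫ x in Ioo a b, u x * (derivative Q).eval x = -∫ x in Ioo a b, v x * Q.eval x

/-- `u 0, …, u m` are square integrable on `(-1, 1)` and each is the derivative of the previous
one. -/
structure IsDerivChain (m : ℕ) (u : ℕ → ℝ → ℝ) : Prop where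
  memLp : ∀ j ≤ m, MemLp (u j) 2 (volume.restrict (Ioo (-1 : ℝ) 1))
  deriv : ∀ j < m, HasPolyWeakDeriv (-1) 1 (u j) (u (j + 1))

lemma IsDerivChain.shift {m : ℕ} {u : ℕ → ℝ → ℝ} (h : IsDerivChain (m + 1) u) :
    IsDerivChain m fun j => u (j + 1) :=
  ⟨fun j hj => h.memLp (j + 1) (by omega), fun j hj => h.deriv (j + 1) (by omega)⟩

/-- The test polynomial `P_{i+2} - P_i` vanishes at both endpoints and its derivative is `(2i+3)
P_{i+1}`. -/
lemma moment_succ {u v : ℝ → ℝ} (hv : MemLp v 2 (volume.restrict (Ioo (-1 : ℝ) 1)))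
    (h : HasPolyWeakDeriv (-1) 1 u v) (i : ℕ) :
    (2 * (i : ℝ) + 3) * moment u (i + 1) = moment v i - moment v (i + 2) := by
  have h1 := h (legendre (i + 2) - legendre i)
    (by rw [eval_sub, eval_legendre_add_two _ (by norm_num), sub_self])
    (by rw [eval_sub, eval_legendre_add_two _ (by norm_num), sub_self])
  rw [derivative_sub, derivative_legendre_add_two, add_sub_cancel_right] at h1
  simp only [eval_mul, eval_C, eval_sub, mul_sub, mul_left_comm _ (2 * (i : ℝ) + 3)] at h1
  rw [integral_const_mul, integral_sub (integrable_mul_of_memLp hv (memLp_two_eval _ _ _))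
    (integrable_mul_of_memLp hv (memLp_two_eval _ _ _))] at h1
  simp only [moment]
  linarith

/-- The `L²(-1, 1)` distance from `u` to the polynomials of degree less than `M`. -/
def projError (M : ℕ) (u : ℝ → ℝ) : ℝ := normL2 (-1) 1 fun x => u x - (proj M u).eval x

lemma projError_le {u : ℝ → ℝ} (hu : MemLp u 2 (volume.restrict (Ioo (-1 : ℝ) 1))) (M : ℕ) :
    projError M u ^ 2 ≤ normL2 (-1) 1 u ^ 2 := by
  have h := (hasSum_nat_add_iff' M).2 (hasSum_moment_sq hu)
  rw [projError, (hasSum_sub_proj hu M).unique h]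
  exact sub_le_self _ (Finset.sum_nonneg fun i _ => by positivity)

lemma moment_sq_le {u : ℝ → ℝ} (hu : MemLp u 2 (volume.restrict (Ioo (-1 : ℝ) 1))) (M i : ℕ) :
    (2 * (i + M : ℕ) + 1) / 2 * moment u (i + M) ^ 2 ≤ projError M u ^ 2 :=
  le_hasSum (hasSum_sub_proj hu M) i fun j _ => by positivity

/-- One derivative is traded for one power of the degree, by comparing the two Parseval tails term
by term. Each term for `u` involves the moments of `v` of order `i + M` and `i + M + 2`, so the tail
of `v` is used twice, each time with factor `4`. -/
lemma projError_succ_le {u v : ℝ → ℝ} (hu : MemLp u 2 (volume.restrict (Ioo (-1 : ℝ) 1)))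
    (hv : MemLp v 2 (volume.restrict (Ioo (-1 : ℝ) 1))) (h : HasPolyWeakDeriv (-1) 1 u v) (M : ℕ) :
    ((M : ℝ) + 2) ^ 2 * projError (M + 1) u ^ 2 ≤ 8 * projError M v ^ 2 := by
  have hA := (hasSum_sub_proj hu (M + 1)).mul_left (((M : ℝ) + 2) ^ 2)
  have hB := hasSum_sub_proj hv M
  have hB2 := (hasSum_nat_add_iff' 2).2 hB
  have hle := hasSum_le (fun i => ?_) hA ((hB.add hB2).mul_left 4)
  · have h0 : 0 ≤ ∑ i ∈ Finset.range 2, (2 * ((i + M : ℕ) : ℝ) + 1) / 2 * moment v (i + M) ^ 2 :=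
      Finset.sum_nonneg fun i _ => by positivity
    simp only [projError] at *
    linarith
  · have h1 := moment_succ hv h (i + M)
    rw [show i + (M + 1) = i + M + 1 by ring, show i + 2 + M = i + M + 2 by ring]
    have hMn : (M : ℝ) ≤ ((i + M : ℕ) : ℝ) := by exact_mod_cast Nat.le_add_left M i
    have hM0 : (0 : ℝ) ≤ M := Nat.cast_nonneg M
    push_cast at h1 hMn ⊢
    generalize (i : ℝ) + M = n at h1 hMn
    generalize moment u (i + M + 1) = α at h1
    generalize moment v (i + M) = β at h1
    generalize moment v (i + M + 2) = γ at h1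
    have hα : α = (β - γ) / (2 * n + 3) := by
      rw [eq_div_iff (by linarith)]; linarith
    have e : ((M : ℝ) + 2) ^ 2 * ((2 * (n + 1) + 1) / 2 * α ^ 2) =
        ((M : ℝ) + 2) ^ 2 * (β - γ) ^ 2 / (2 * (2 * n + 3)) := by
      have : 2 * n + 3 ≠ 0 := by linarith
      rw [hα]; field_simp; ring
    rw [e, div_le_iff₀ (by linarith)]
    have h2 : ((M : ℝ) + 2) ^ 2 ≤ 2 * ((2 * n + 1) * (2 * n + 3)) := by nlinarith
    calc ((M : ℝ) + 2) ^ 2 * (β - γ) ^ 2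
        ≤ (2 * ((2 * n + 1) * (2 * n + 3))) * (2 * (β ^ 2 + γ ^ 2)) :=
          mul_le_mul h2 (by nlinarith [sq_nonneg (β + γ)]) (sq_nonneg _) ((sq_nonneg _).trans h2)
      _ ≤ _ := by
          have : 0 ≤ γ ^ 2 * (2 * n + 3) := mul_nonneg (sq_nonneg _) (by linarith)
          nlinarith

lemma natCast_add_two_pow_le (M p : ℕ) : ((M : ℝ) + 2) ^ p ≤ 2 ^ p * ((M : ℝ) + 1) ^ p := by
  rw [← mul_pow]
  gcongr
  linarith [(Nat.cast_nonneg M : (0 : ℝ) ≤ M)]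

/-- The Jackson inequality for the Legendre projection in `L²(-1, 1)`. -/
theorem exists_projError_le (m : ℕ) :
    ∃ K : ℝ, 0 < K ∧ ∀ u : ℕ → ℝ → ℝ, IsDerivChain m u → ∀ M : ℕ,
      ((M : ℝ) + 1) ^ (2 * m) * projError M (u 0) ^ 2 ≤ K * normL2 (-1) 1 (u (min m M)) ^ 2 := by
  induction m with
  | zero =>
    refine ⟨1, one_pos, fun u hu M => ?_⟩
    simpa using projError_le (hu.memLp 0 le_rfl) M
  | succ m ih =>
    obtain ⟨K, hK, ih⟩ := ih
    -- The product is the cost of one descent step, with `2 ^ (2 * m)` replacing `M + 2` by `M + 1`;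
    -- the summand `1` covers `M = 0`, where the projection is zero.
    refine ⟨8 * 2 ^ (2 * m) * K + 1, by positivity, fun u hu M => ?_⟩
    rcases M with _ | M
    · simp only [projError, Nat.cast_zero, zero_add, one_pow, one_mul, proj_zero, eval_zero,
        sub_zero, Nat.min_zero]
      have h0 : 0 < 8 * 2 ^ (2 * m) * K := by positivity
      exact le_mul_of_one_le_left (sq_nonneg _) (by linarith)
    · have h1 := projError_succ_le (hu.memLp 0 (by omega)) (hu.memLp 1 (by omega))
        (hu.deriv 0 (by omega)) M
      have h2 := ih _ hu.shift M
      rw [Nat.add_min_add_right]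
      push_cast
      rw [add_assoc, one_add_one_eq_two]
      calc ((M : ℝ) + 2) ^ (2 * (m + 1)) * projError (M + 1) (u 0) ^ 2
          = ((M : ℝ) + 2) ^ (2 * m) * (((M : ℝ) + 2) ^ 2 * projError (M + 1) (u 0) ^ 2) := by ring
        _ ≤ (2 ^ (2 * m) * ((M : ℝ) + 1) ^ (2 * m)) * (8 * projError M (u 1) ^ 2) := by
          gcongr
          exact natCast_add_two_pow_le _ _
        _ = 8 * 2 ^ (2 * m) * (((M : ℝ) + 1) ^ (2 * m) * projError M (u (0 + 1)) ^ 2) := by ring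
        _ ≤ 8 * 2 ^ (2 * m) * (K * normL2 (-1) 1 (u (min m M + 1)) ^ 2) := by gcongr
        _ ≤ _ := by nlinarith [sq_nonneg (normL2 (-1) 1 (u (min m M + 1)))]

/-! ### Derivatives of the projection error on the reference interval -/

lemma derivative_legendre_succ (i : ℕ) :
    derivative (legendre (i + 1)) =
      C (2 * (i : ℝ) + 1) * legendre i + derivative (legendre (i - 1)) := by
  -- For `i = 0` the truncated index `i - 1` is `0`, harmless because `P_0' = 0`.
  rcases i with _ | i
  · simp
  · rw [derivative_legendre_add_two, Nat.add_sub_cancel]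
    push_cast
    ring_nf

/-- The commutator of differentiation and projection. -/
lemma derivative_proj_succ {u v : ℝ → ℝ} (hv : MemLp v 2 (volume.restrict (Ioo (-1 : ℝ) 1)))
    (h : HasPolyWeakDeriv (-1) 1 u v) (M : ℕ) :
    derivative (proj (M + 1) u) =
      proj M v - (C (moment v (M + 1) / 2) * derivative (legendre M) +
        C (moment v M / 2) * derivative (legendre (M - 1))) := by
  induction M with
  | zero => simp [proj]
  | succ M ih =>
    have hm : (2 * ((M + 1 : ℕ) : ℝ) + 1) / 2 * moment u (M + 1) =
        moment v M / 2 - moment v (M + 2) / 2 := by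
      push_cast
      linarith [moment_succ hv h M]
    rw [proj_succ (M + 1), derivative_add, ih, proj_succ M v, derivative_C_mul, hm,
      Nat.add_sub_cancel, show M + 1 + 1 = M + 2 from rfl]
    have e : C ((2 * (M : ℝ) + 1) / 2 * moment v M) * legendre M =
        C (moment v M / 2) * (C (2 * (M : ℝ) + 1) * legendre M) := by
      rw [← mul_assoc, ← C_mul]; congr 2; ring
    rw [e, C_sub, sub_mul]
    -- Only the copy of `P_{M+1}'` with coefficient `moment v M / 2` is expanded: its `P_M` part is
    -- the new term of `proj (M + 1) v`, and its `P_{M-1}'` part cancels the old commutator term.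
    nth_rewrite 1 [derivative_legendre_succ M]
    ring

/-- The `L²(-1, 1)` norm of the `s`-th derivative of the projection error. -/
def projErrorDeriv (s M : ℕ) (u : ℕ → ℝ → ℝ) : ℝ :=
  normL2 (-1) 1 fun x => u s x - (derivative^[s] (proj M (u 0))).eval x

/-- The first term is the error of projecting `u'`, the second the commutator. The squared norms of
the Legendre derivatives contribute `(M + 1) ^ (4 * s + 2)`; the bound on the squared moments by `E²
/ (M + 1)` removes one power, which is the origin of the `1/2` in the final exponent. -/
lemma projErrorDeriv_succ_succ_le {m s : ℕ} (hs : s ≤ m) {u : ℕ → ℝ → ℝ}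
    (hu : IsDerivChain (m + 1) u) (M : ℕ) :
    projErrorDeriv (s + 1) (M + 1) u ^ 2 ≤
      2 * projErrorDeriv s M (fun j => u (j + 1)) ^ 2 +
        4 * projError M (u 1) ^ 2 * ((M : ℝ) + 1) ^ (4 * s + 1) := by
  have hv := hu.memLp 1 (by omega)
  set β := moment (u 1) M with hβ
  set γ := moment (u 1) (M + 1) with hγ
  set F := projErrorDeriv s M (fun j => u (j + 1)) with hF
  set E := projError M (u 1) with hE
  have hβ2 : ((M : ℝ) + 1) * β ^ 2 ≤ 2 * E ^ 2 := by
    have := moment_sq_le hv M 0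
    rw [zero_add] at this
    nlinarith [mul_nonneg (Nat.cast_nonneg M : (0 : ℝ) ≤ M) (sq_nonneg β)]
  have hγ2 : ((M : ℝ) + 1) * γ ^ 2 ≤ 2 * E ^ 2 := by
    have := moment_sq_le hv M 1
    rw [add_comm 1 M] at this
    push_cast at this
    nlinarith [mul_nonneg (Nat.cast_nonneg M : (0 : ℝ) ≤ M) (sq_nonneg γ), sq_nonneg γ]
  have hle : projErrorDeriv (s + 1) (M + 1) u ≤
      F + (|γ| / 2 * ((M : ℝ) + 1) ^ (2 * s + 1) + |β| / 2 * ((M : ℝ) + 1) ^ (2 * s + 1)) := by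
    have e : ∀ x, u (s + 1) x - (derivative^[s + 1] (proj (M + 1) (u 0))).eval x =
        (u (s + 1) x - (derivative^[s] (proj M (u 1))).eval x) +
        (γ / 2 * (derivative^[s + 1] (legendre M)).eval x +
          β / 2 * (derivative^[s + 1] (legendre (M - 1))).eval x) := by
      intro x
      rw [Function.iterate_succ_apply, derivative_proj_succ hv (hu.deriv 0 (by omega)),
        iterate_derivative_sub, iterate_map_add, iterate_derivative_C_mul,
        iterate_derivative_C_mul, ← Function.iterate_succ_apply derivative,
        ← Function.iterate_succ_apply derivative]
      simp only [eval_add, eval_sub, eval_mul, eval_C, hβ, hγ]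
      ring
    simp only [projErrorDeriv, e]
    have m1 : MemLp (fun x => u (s + 1) x - (derivative^[s] (proj M (u 1))).eval x) 2
        (volume.restrict (Ioo (-1 : ℝ) 1)) :=
      (hu.memLp (s + 1) (by omega)).sub (memLp_two_eval _ _ _)
    have m2 := (memLp_two_eval (derivative^[s + 1] (legendre M)) (-1) 1).const_mul (γ / 2)
    have m3 := (memLp_two_eval (derivative^[s + 1] (legendre (M - 1))) (-1) 1).const_mul (β / 2)
    refine (normL2_add_le m1 (m2.add m3)).trans ?_
    refine add_le_add le_rfl ((normL2_add_le m2 m3).trans ?_)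
    rw [normL2_const_mul, normL2_const_mul, abs_div, abs_div, abs_two]
    gcongr
    · exact normL2_iterate_derivative_legendre_le s M
    · refine (normL2_iterate_derivative_legendre_le s (M - 1)).trans ?_
      gcongr
      omega
  have hP : 0 ≤ projErrorDeriv (s + 1) (M + 1) u := normL2_nonneg _ _ _
  set y := ((M : ℝ) + 1) with hy
  have hy0 : 0 < y := by positivity
  calc projErrorDeriv (s + 1) (M + 1) u ^ 2
      ≤ (F + (|γ| / 2 * y ^ (2 * s + 1) + |β| / 2 * y ^ (2 * s + 1))) ^ 2 := by gcongr
    _ ≤ 2 * F ^ 2 + (γ ^ 2 + β ^ 2) * (y ^ (2 * s + 1)) ^ 2 := by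
      rw [← sq_abs γ, ← sq_abs β]
      nlinarith [sq_nonneg (F - (|γ| / 2 * y ^ (2 * s + 1) + |β| / 2 * y ^ (2 * s + 1))),
        mul_nonneg (sq_nonneg (|γ| - |β|)) (sq_nonneg (y ^ (2 * s + 1)))]
    _ = 2 * F ^ 2 + (y * γ ^ 2 + y * β ^ 2) * y ^ (4 * s + 1) := by ring
    _ ≤ 2 * F ^ 2 + (2 * E ^ 2 + 2 * E ^ 2) * y ^ (4 * s + 1) := by gcongr
    _ = _ := by ring

/-- The squared seminorm `∑_{j = min (m, M)}^m ‖u_j‖²`. -/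
def tailNormSq (m M : ℕ) (u : ℕ → ℝ → ℝ) : ℝ :=
  ∑ j ∈ Finset.Icc (min m M) m, normL2 (-1) 1 (u j) ^ 2

lemma tailNormSq_nonneg (m M : ℕ) (u : ℕ → ℝ → ℝ) : 0 ≤ tailNormSq m M u :=
  Finset.sum_nonneg fun _ _ => sq_nonneg _

lemma le_tailNormSq {m M j : ℕ} (h1 : min m M ≤ j) (h2 : j ≤ m) (u : ℕ → ℝ → ℝ) :
    normL2 (-1) 1 (u j) ^ 2 ≤ tailNormSq m M u :=
  Finset.single_le_sum (f := fun j => normL2 (-1) 1 (u j) ^ 2) (fun _ _ => sq_nonneg _)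
    (Finset.mem_Icc.2 ⟨h1, h2⟩)

lemma tailNormSq_succ_succ (m M : ℕ) (u : ℕ → ℝ → ℝ) :
    tailNormSq (m + 1) (M + 1) u = tailNormSq m M fun j => u (j + 1) := by
  rw [tailNormSq, tailNormSq, Nat.add_min_add_right]
  exact (Finset.sum_Ico_add' (fun j => normL2 (-1) 1 (u j) ^ 2) (min m M) (m + 1) 1).symm

/-- The hypothesis lacks the extra half power that the conclusion has, so it is also available for
`s = 0`. It suffices because the inherited error carries only `(M + 1) ^ 3` where the commutator
carries `(M + 1) ^ 4`. -/
lemma exists_projErrorDeriv_succ_le {m s : ℕ} (hs : s ≤ m)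
    (h : ∃ K : ℝ, 0 < K ∧ ∀ u : ℕ → ℝ → ℝ, IsDerivChain m u → ∀ M : ℕ,
      ((M : ℝ) + 1) ^ (2 * m) * projErrorDeriv s M u ^ 2 ≤
        K * ((M : ℝ) + 1) ^ (4 * s) * tailNormSq m M u) :
    ∃ K : ℝ, 0 < K ∧ ∀ u : ℕ → ℝ → ℝ, IsDerivChain (m + 1) u → ∀ M : ℕ,
      ((M : ℝ) + 1) ^ (2 * (m + 1) + 1) * projErrorDeriv (s + 1) M u ^ 2 ≤
        K * ((M : ℝ) + 1) ^ (4 * (s + 1)) * tailNormSq (m + 1) M u := by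
  obtain ⟨K, hK, h⟩ := h
  obtain ⟨L, hL, hE⟩ := exists_projError_le m
  refine ⟨2 ^ (2 * (m + 1) + 1) * (2 * K + 4 * L) + 1, by positivity, fun u hu M => ?_⟩
  rcases M with _ | M
  -- With `M = 0` the error is `u (s + 1)` itself, which is why the seminorm must contain every
  -- order from `min m M` up to `m`.
  · have h1 := le_tailNormSq (m := m + 1) (M := 0) (j := s + 1) (by simp) (by omega) u
    simp only [projErrorDeriv, Nat.cast_zero, zero_add, one_pow, one_mul, proj_zero,
      iterate_map_zero, eval_zero, sub_zero, mul_one]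
    refine h1.trans (le_mul_of_one_le_left (tailNormSq_nonneg _ _ _) ?_)
    linarith [show 0 < 2 ^ (2 * (m + 1) + 1) * (2 * K + 4 * L) by positivity]
  · have h1 := projErrorDeriv_succ_succ_le hs hu M
    have h2 := h _ hu.shift M
    have h3 := (hE _ hu.shift M).trans
      (mul_le_mul_of_nonneg_left
        (le_tailNormSq le_rfl (min_le_left m M) fun j => u (j + 1)) hL.le)
    rw [tailNormSq_succ_succ]
    have hT := tailNormSq_nonneg m M fun j => u (j + 1)
    set T := tailNormSq m M fun j => u (j + 1)
    set F := projErrorDeriv s M fun j => u (j + 1)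
    simp only [zero_add] at h3
    set E := projError M (u 1)
    push_cast
    rw [add_assoc (M : ℝ), one_add_one_eq_two]
    have hy : (1 : ℝ) ≤ (M : ℝ) + 1 := by linarith [(Nat.cast_nonneg M : (0 : ℝ) ≤ M)]
    have hp := natCast_add_two_pow_le M (2 * (m + 1) + 1)
    have hyz : (M : ℝ) + 1 ≤ (M : ℝ) + 2 := by linarith
    set y := (M : ℝ) + 1
    set z := (M : ℝ) + 2
    have hz : 0 < z := by linarith
    calc z ^ (2 * (m + 1) + 1) * projErrorDeriv (s + 1) (M + 1) u ^ 2
        ≤ (2 ^ (2 * (m + 1) + 1) * y ^ (2 * (m + 1) + 1)) *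
          (2 * F ^ 2 + 4 * E ^ 2 * y ^ (4 * s + 1)) := by gcongr
      _ = 2 ^ (2 * (m + 1) + 1) * (2 * y ^ 3 * (y ^ (2 * m) * F ^ 2) +
          4 * y ^ (4 * (s + 1)) * (y ^ (2 * m) * E ^ 2)) := by ring
      _ ≤ 2 ^ (2 * (m + 1) + 1) * (2 * y ^ 4 * (K * y ^ (4 * s) * T) +
          4 * y ^ (4 * (s + 1)) * (L * T)) := by
        have : 0 ≤ K * y ^ (4 * s) * T := by positivity
        gcongr
        norm_num
      _ = 2 ^ (2 * (m + 1) + 1) * (2 * K + 4 * L) * y ^ (4 * (s + 1)) * T := by ring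
      _ ≤ (2 ^ (2 * (m + 1) + 1) * (2 * K + 4 * L) + 1) * z ^ (4 * (s + 1)) * T := by
        gcongr
        linarith

/-- The version without the half-power gain, uniform over `s ≥ 0`, is what the induction on `s` can
carry. -/
lemma exists_pow_mul_projErrorDeriv_le (s : ℕ) :
    ∀ m, s ≤ m → ∃ K : ℝ, 0 < K ∧ ∀ u : ℕ → ℝ → ℝ, IsDerivChain m u → ∀ M : ℕ,
      ((M : ℝ) + 1) ^ (2 * m) * projErrorDeriv s M u ^ 2 ≤
        K * ((M : ℝ) + 1) ^ (4 * s) * tailNormSq m M u := by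
  induction s with
  | zero =>
    intro m _
    obtain ⟨L, hL, hE⟩ := exists_projError_le m
    refine ⟨L, hL, fun u hu M => ?_⟩
    simpa [projErrorDeriv, projError] using (hE _ hu M).trans
      (mul_le_mul_of_nonneg_left (le_tailNormSq le_rfl (min_le_left m M) _) hL.le)
  | succ s ih =>
    intro m hm
    obtain ⟨m, rfl⟩ : ∃ n, m = n + 1 := ⟨m - 1, by omega⟩
    obtain ⟨K, hK, h⟩ := exists_projErrorDeriv_succ_le (by omega) (ih m (by omega))
    refine ⟨K, hK, fun u hu M => le_trans ?_ (h u hu M)⟩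
    gcongr
    · linarith [(Nat.cast_nonneg M : (0 : ℝ) ≤ M)]
    · omega

/-- The error of the Legendre projection in the seminorm of order `s ≥ 1`. -/
theorem exists_projErrorDeriv_le {m s : ℕ} (hs : 1 ≤ s) (hsm : s ≤ m) :
    ∃ K : ℝ, 0 < K ∧ ∀ u : ℕ → ℝ → ℝ, IsDerivChain m u → ∀ M : ℕ,
      ((M : ℝ) + 1) ^ (2 * m + 1) * projErrorDeriv s M u ^ 2 ≤
        K * ((M : ℝ) + 1) ^ (4 * s) * tailNormSq m M u := by
  obtain ⟨m, rfl⟩ : ∃ n, m = n + 1 := ⟨m - 1, by omega⟩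
  obtain ⟨s, rfl⟩ : ∃ n, s = n + 1 := ⟨s - 1, by omega⟩
  exact exists_projErrorDeriv_succ_le (by omega) (exists_pow_mul_projErrorDeriv_le s m (by omega))

section WeakDeriv

/-! ### Weak derivatives -/

lemma iteratedDeriv_eq_zero_of_notMem {φ : ℝ → ℝ} {x : ℝ} (hx : x ∉ tsupport φ) (j : ℕ) :
    iteratedDeriv j φ x = 0 := by
  have h : φ =ᶠ[𝓝 x] 0 := notMem_tsupport_iff_eventuallyEq.1 hx
  rw [h.iteratedDeriv_eq j]
  simp

lemma setIntegral_mul_eq_of_tsupport_subset {s t : Set ℝ}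
    (ht : MeasurableSet t) (hst : s ⊆ t) {φ : ℝ → ℝ} (hφ : tsupport φ ⊆ s) (f : ℝ → ℝ) (j : ℕ) :
    ∫ x in s, f x * iteratedDeriv j φ x = ∫ x in t, f x * iteratedDeriv j φ x := by
  refine (setIntegral_eq_of_subset_of_forall_sdiff_eq_zero ht hst fun x hx => ?_).symm
  rw [iteratedDeriv_eq_zero_of_notMem (fun h => hx.2 (hφ h)), mul_zero]

lemma integrable_mul_of_tsupport_subset {s : Set ℝ} {g φ : ℝ → ℝ}
    (hg : LocallyIntegrableOn g s) (hφ : Continuous φ) (hc : HasCompactSupport φ)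
    (hs : tsupport φ ⊆ s) : Integrable fun x => g x * φ x := by
  have h1 : IntegrableOn (fun x => g x * φ x) (tsupport φ) :=
    (hg.integrableOn_compact_subset hs hc).mul_continuousOn hφ.continuousOn hc
  refine (integrableOn_iff_integrable_of_support_subset ?_).1 h1
  intro x hx
  exact subset_tsupport φ (right_ne_zero_of_mul hx)

variable {a b : ℝ} {j : ℕ} {f g : ℝ → ℝ}

/-- Weak derivatives are unique almost everywhere. -/
lemma HasWeakDeriv.ae_eq {g' : ℝ → ℝ} (h : HasWeakDeriv a b j f g) (h' : HasWeakDeriv a b j f g') :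
    g =ᵐ[volume.restrict (Ioo a b)] g' := by
  have := isOpen_Ioo.ae_eq_zero_of_integral_contDiff_smul_eq_zero (μ := volume)
    (U := Ioo a b) (f := g - g') (h.2.1.sub h'.2.1) (by
      intro φ hφ hc hs
      have e : ∀ v : ℝ → ℝ, ∫ x, v x * φ x = ∫ x in Ioo a b, v x * φ x := by
        intro v
        simpa using (setIntegral_mul_eq_of_tsupport_subset MeasurableSet.univ
          (subset_univ _) hs v 0).symm
      have h1 := h.2.2 φ hφ hc hs
      rw [h'.2.2 φ hφ hc hs] at h1
      have h2 := mul_left_cancel₀ (pow_ne_zero j (by norm_num : (-1 : ℝ) ≠ 0)) h1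
      simp only [Pi.sub_apply, smul_eq_mul, mul_comm (φ _), sub_mul]
      rw [integral_sub (integrable_mul_of_tsupport_subset h.2.1 hφ.continuous hc hs)
        (integrable_mul_of_tsupport_subset h'.2.1 hφ.continuous hc hs), e, e, h2, sub_self])
  rw [EventuallyEq, ae_restrict_iff' measurableSet_Ioo]
  filter_upwards [this] with x hx hx'
  exact sub_eq_zero.1 (hx hx')

lemma HasWeakDeriv.hasWeakDeriv_weakDeriv (h : HasWeakDeriv a b j f g) :
    HasWeakDeriv a b j f (weakDeriv a b j f) := by
  have h' : ∃ g, HasWeakDeriv a b j f g := ⟨g, h⟩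
  rw [weakDeriv, dif_pos h']
  exact h'.choose_spec

lemma HasWeakDeriv.weakDeriv_ae_eq (h : HasWeakDeriv a b j f g) :
    weakDeriv a b j f =ᵐ[volume.restrict (Ioo a b)] g :=
  h.hasWeakDeriv_weakDeriv.ae_eq h

lemma HasWeakDeriv.mono {c d : ℝ} (h : HasWeakDeriv a b j f g) (hs : Ioo c d ⊆ Ioo a b) :
    HasWeakDeriv c d j f g := by
  refine ⟨h.1.mono_set hs, h.2.1.mono_set hs, fun φ hφ hc ht => ?_⟩
  have h1 := h.2.2 φ hφ hc (ht.trans hs)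
  rw [← setIntegral_mul_eq_of_tsupport_subset measurableSet_Ioo hs ht f j] at h1
  have h2 := setIntegral_mul_eq_of_tsupport_subset measurableSet_Ioo hs ht g 0
  simp only [iteratedDeriv_zero] at h2
  rw [h1, h2]

lemma HasWeakDeriv.congr {f' : ℝ → ℝ} (h : HasWeakDeriv a b j f g) (hf : EqOn f' f (Ioo a b)) :
    HasWeakDeriv a b j f' g := by
  refine ⟨h.1.congr ?_, h.2.1, fun φ hφ hc ht => ?_⟩
  · filter_upwards [ae_restrict_mem measurableSet_Ioo] with x hx
    exact (hf hx).symm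
  · rw [← h.2.2 φ hφ hc ht]
    exact setIntegral_congr_fun measurableSet_Ioo fun x hx => by simp only [hf hx]

lemma HasWeakDeriv.sub {f' g' : ℝ → ℝ} (h : HasWeakDeriv a b j f g)
    (h' : HasWeakDeriv a b j f' g') :
    HasWeakDeriv a b j (fun x => f x - f' x) fun x => g x - g' x := by
  refine ⟨h.1.sub h'.1, h.2.1.sub h'.2.1, fun φ hφ hc ht => ?_⟩
  have hcont : Continuous (iteratedDeriv j φ) :=
    hφ.continuous_iteratedDeriv j (by exact_mod_cast le_top)
  have hsub : tsupport (iteratedDeriv j φ) ⊆ tsupport φ := by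
    refine closure_minimal (fun x hx => ?_) (isClosed_tsupport φ)
    by_contra hx'
    exact hx (iteratedDeriv_eq_zero_of_notMem hx' j)
  have hc' : HasCompactSupport (iteratedDeriv j φ) := hc.of_isClosed_subset (isClosed_tsupport _) hsub
  simp only [sub_mul]
  rw [integral_sub
      (integrable_mul_of_tsupport_subset h.1 hcont hc' (hsub.trans ht)).integrableOn
      (integrable_mul_of_tsupport_subset h'.1 hcont hc' (hsub.trans ht)).integrableOn,
    integral_sub
      (integrable_mul_of_tsupport_subset h.2.1 hφ.continuous hc ht).integrableOn
      (integrable_mul_of_tsupport_subset h'.2.1 hφ.continuous hc ht).integrableOn,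
    h.2.2 φ hφ hc ht, h'.2.2 φ hφ hc ht]
  ring

lemma hasWeakDeriv_eval (hab : a ≤ b) (p : ℝ[X]) (j : ℕ) :
    HasWeakDeriv a b j (fun x => p.eval x) fun x => (derivative^[j] p).eval x := by
  refine ⟨p.continuous.locallyIntegrable.locallyIntegrableOn _,
    (derivative^[j] p).continuous.locallyIntegrable.locallyIntegrableOn _, ?_⟩
  induction j with
  | zero => intro φ _ _ _; simp
  | succ j ih =>
    intro φ hφ hc ht
    have hd : ContDiff ℝ ∞ (deriv φ) := (contDiff_infty_iff_deriv.1 hφ).2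
    have h0 : ∀ x, x ∉ Ioo a b → φ x = 0 := fun x hx =>
      image_eq_zero_of_notMem_tsupport fun h => hx (ht h)
    rw [iteratedDeriv_succ', ih (deriv φ) hd hc.deriv (tsupport_deriv_subset.trans ht),
      setIntegral_Ioo_eq hab, setIntegral_Ioo_eq hab,
      intervalIntegral.integral_mul_deriv_eq_deriv_mul
        (fun x _ => (derivative^[j] p).hasDerivAt x)
        (fun x _ => (hφ.differentiable (by simp) x).hasDerivAt)
        ((derivative (derivative^[j] p)).continuous.intervalIntegrable _ _)
        (hd.continuous.intervalIntegrable _ _), h0 a (by simp), h0 b (by simp),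
        Function.iterate_succ_apply']
    ring

/-! ### Integration by parts against polynomials vanishing at the endpoints -/

/-- The derivative of the transition vanishes outside a bounded set. This makes the derivatives of
the shrinking cutoffs below bounded uniformly after multiplication by a function vanishing at the
endpoints. -/
lemma exists_bound_mul_deriv_smoothTransition :
    ∃ K : ℝ, ∀ y : ℝ, |y * deriv Real.smoothTransition (y - 1)| ≤ K := by
  have hc : Continuous fun y : ℝ => y * deriv Real.smoothTransition (y - 1) :=
    continuous_id.mul (((Real.smoothTransition.contDiff (n := 1)).continuous_deriv le_rfl).comp
      (continuous_id.sub continuous_const))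
  obtain ⟨K, hK⟩ := isCompact_Icc.exists_bound_of_continuousOn (s := Icc (0 : ℝ) 3) hc.continuousOn
  refine ⟨max K 0, fun y => ?_⟩
  by_cases hy : y ∈ Icc (0 : ℝ) 3
  · exact (hK y hy).trans (le_max_left _ _)
  · have h : deriv Real.smoothTransition (y - 1) = 0 := by
      rcases lt_or_ge y 0 with h | h
      · have : Real.smoothTransition =ᶠ[𝓝 (y - 1)] fun _ => 0 := by
          filter_upwards [Iio_mem_nhds (show y - 1 < 0 by linarith)] with z hz
          exact Real.smoothTransition.zero_of_nonpos (le_of_lt hz)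
        rw [this.deriv_eq, deriv_const]
      · have : Real.smoothTransition =ᶠ[𝓝 (y - 1)] fun _ => 1 := by
          have h3 : 3 < y := by by_contra h3; exact hy ⟨h, not_lt.1 h3⟩
          filter_upwards [Ioi_mem_nhds (show 1 < y - 1 by linarith)] with z hz
          exact Real.smoothTransition.one_of_one_le (le_of_lt hz)
        rw [this.deriv_eq, deriv_const]
    simp [h]

lemma tendsto_setIntegral_mul_of_eventually_eq {u : ℝ → ℝ} (hu : IntegrableOn u (Ioo a b))
    {F : ℕ → ℝ → ℝ} {G : ℝ → ℝ} (hF : ∀ n, Continuous (F n)) {B : ℝ}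
    (hB : ∀ n, ∀ x ∈ Ioo a b, |F n x| ≤ B)
    (hlim : ∀ x ∈ Ioo a b, ∀ᶠ n in atTop, F n x = G x) :
    Tendsto (fun n => ∫ x in Ioo a b, u x * F n x) atTop (𝓝 (∫ x in Ioo a b, u x * G x)) := by
  refine tendsto_integral_of_dominated_convergence (fun x => |u x| * B)
    (fun n => hu.aestronglyMeasurable.mul (hF n).aestronglyMeasurable) (hu.abs.mul_const B)
    (fun n => ?_) ?_
  · filter_upwards [ae_restrict_mem measurableSet_Ioo] with x hx
    rw [Real.norm_eq_abs, abs_mul]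
    gcongr
    exact hB n x hx
  · filter_upwards [ae_restrict_mem measurableSet_Ioo] with x hx
    refine tendsto_const_nhds.congr' ?_
    filter_upwards [hlim x hx] with n hn
    rw [hn]

lemma contDiff_eval (p : ℝ[X]) {n : ℕ∞ω} : ContDiff ℝ n fun x => p.eval x := by
  simpa [coe_aeval_eq_eval] using p.contDiff_aeval (𝕜 := ℝ) n

/-- A weak derivative may be tested against polynomials vanishing at the endpoints. -/
lemma hasPolyWeakDeriv_of_forall_test (hab : a < b) {u v : ℝ → ℝ} (hu : IntegrableOn u (Ioo a b))
    (hv : IntegrableOn v (Ioo a b))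
    (h : ∀ φ : ℝ → ℝ, ContDiff ℝ ∞ φ → HasCompactSupport φ → tsupport φ ⊆ Ioo a b →
      ∫ x in Ioo a b, u x * deriv φ x = -∫ x in Ioo a b, v x * φ x) :
    HasPolyWeakDeriv a b u v := by
  intro Q hQa hQb
  set W : ℝ[X] := (X - C a) * (C b - X) with hW
  obtain ⟨R, rfl⟩ : ∃ R, Q = W * R := by
    obtain ⟨q, rfl⟩ := dvd_iff_isRoot.2 hQa
    have hq : q.IsRoot b := by
      simp only [eval_mul, eval_sub, eval_X, eval_C] at hQb
      exact (mul_eq_zero.1 hQb).resolve_left (sub_ne_zero.2 hab.ne')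
    obtain ⟨r, rfl⟩ := dvd_iff_isRoot.2 hq
    exact ⟨-r, by rw [hW]; ring⟩
  have hWx : ∀ x, W.eval x = (x - a) * (b - x) := fun x => by simp [hW]
  have hWpos : ∀ x, 0 < W.eval x ↔ x ∈ Ioo a b := by
    intro x
    rw [hWx]
    constructor
    · intro hx
      constructor <;> by_contra hc <;> nlinarith
    · rintro ⟨h1, h2⟩
      exact mul_pos (by linarith) (by linarith)
  set st := Real.smoothTransition with hst
  have hstd : ∀ x, HasDerivAt st (deriv st x) x := fun x =>
    ((Real.smoothTransition.contDiff (n := 1)).differentiable one_ne_zero x).hasDerivAt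
  have hstc : Continuous (deriv st) :=
    (Real.smoothTransition.contDiff (n := 1)).continuous_deriv le_rfl
  -- The cutoff vanishes where `n W ≤ 1` and equals `1` where `n W ≥ 2`, so `φ n` is compactly
  -- supported in `(a, b)` and at each interior point is eventually equal to `W R`.
  set φ : ℕ → ℝ → ℝ := fun n x => (W * R).eval x * st (n * W.eval x - 1) with hφ
  set φ' : ℕ → ℝ → ℝ := fun n x => (derivative (W * R)).eval x * st (n * W.eval x - 1) +
    (W * R).eval x * (deriv st (n * W.eval x - 1) * (n * (derivative W).eval x)) with hφ'
  have hderiv : ∀ n x, HasDerivAt (φ n) (φ' n x) x := by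
    intro n x
    exact ((W * R).hasDerivAt x).mul
      ((hstd _).comp x (((W.hasDerivAt x).const_mul (n : ℝ)).sub_const 1))
  have hsmooth : ∀ n, ContDiff ℝ ∞ (φ n) := by
    intro n
    exact (contDiff_eval (W * R)).mul
      (Real.smoothTransition.contDiff.comp ((contDiff_const.mul (contDiff_eval W)).sub contDiff_const))
  have htsupp : ∀ n, tsupport (φ n) ⊆ Ioo a b := by
    intro n
    have h1 : tsupport (φ n) ⊆ {x | 1 ≤ n * W.eval x} := by
      refine closure_minimal (fun x hx => ?_)
        (isClosed_le continuous_const (continuous_const.mul W.continuous))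
      by_contra hx'
      refine hx ?_
      simp only [hφ, hst]
      rw [Real.smoothTransition.zero_of_nonpos, mul_zero]
      have : n * W.eval x < 1 := not_le.1 hx'
      linarith
    intro x hx
    have h2 : 1 ≤ n * W.eval x := h1 hx
    rw [← hWpos]
    exact pos_of_mul_pos_right (by linarith : 0 < (n : ℝ) * W.eval x) (Nat.cast_nonneg n)
  have hcomp : ∀ n, HasCompactSupport (φ n) := fun n =>
    isCompact_Icc.of_isClosed_subset (isClosed_tsupport _)
      ((htsupp n).trans Ioo_subset_Icc_self)
  have hev : ∀ x ∈ Ioo a b, ∀ᶠ n : ℕ in atTop, 2 < n * W.eval x := fun x hx =>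
    (tendsto_natCast_atTop_atTop.atTop_mul_const ((hWpos x).2 hx)).eventually_gt_atTop 2
  obtain ⟨K, hK⟩ := exists_bound_mul_deriv_smoothTransition
  obtain ⟨B₁, hB₁⟩ := isCompact_Icc.exists_bound_of_continuousOn (s := Icc a b)
    (W * R).continuous.continuousOn
  obtain ⟨B₂, hB₂⟩ := isCompact_Icc.exists_bound_of_continuousOn (s := Icc a b)
    (derivative (W * R)).continuous.continuousOn
  obtain ⟨B₃, hB₃⟩ := isCompact_Icc.exists_bound_of_continuousOn (s := Icc a b)
    (R * derivative W).continuous.continuousOn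
  have hst1 : ∀ y, |st y| ≤ 1 := fun y => by
    rw [abs_of_nonneg (Real.smoothTransition.nonneg y)]
    exact Real.smoothTransition.le_one y
  have hlim₁ := tendsto_setIntegral_mul_of_eventually_eq hv (F := φ) (G := fun x => (W * R).eval x)
    (fun n => (hsmooth n).continuous) (B := B₁) (fun n x hx => by
      simp only [hφ, abs_mul (eval x (W * R))]
      exact (mul_le_of_le_one_right (abs_nonneg _) (hst1 _)).trans
        (hB₁ x (Ioo_subset_Icc_self hx)))
    (fun x hx => by
      filter_upwards [hev x hx] with n hn
      simp only [hφ, hst]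
      rw [Real.smoothTransition.one_of_one_le (by linarith), mul_one])
  have hlim₂ := tendsto_setIntegral_mul_of_eventually_eq hu (F := φ')
    (G := fun x => (derivative (W * R)).eval x)
    (fun n => by
      have := hst ▸ Real.smoothTransition.continuous
      simp only [hφ']
      fun_prop) (B := B₂ + B₃ * K) (fun n x hx => by
      have hx' := Ioo_subset_Icc_self hx
      refine (abs_add_le _ _).trans (add_le_add ?_ ?_)
      · rw [abs_mul]
        exact (mul_le_of_le_one_right (abs_nonneg _) (hst1 _)).trans (hB₂ x hx')
      -- The growing factor `n` is paired with the factor `W` of the test polynomial, giving `y *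
      -- st' (y - 1)` at `y = n W`, bounded by `K` independently of `n`.
      · have e : (W * R).eval x * (deriv st (n * W.eval x - 1) * (n * (derivative W).eval x)) =
            (R * derivative W).eval x * (n * W.eval x * deriv st (n * W.eval x - 1)) := by
          simp only [eval_mul]; ring
        rw [e, abs_mul]
        exact mul_le_mul (hB₃ x hx') (hK _) (abs_nonneg _) ((norm_nonneg _).trans (hB₃ x hx')))
    (fun x hx => by
      filter_upwards [hev x hx] with n hn
      have h1 : st =ᶠ[𝓝 (n * W.eval x - 1)] fun _ => 1 := by
        filter_upwards [Ioi_mem_nhds (show 1 < n * W.eval x - 1 by linarith)] with z hz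
        exact Real.smoothTransition.one_of_one_le (le_of_lt hz)
      simp only [hφ']
      rw [h1.deriv_eq, h1.eq_of_nhds, deriv_const]
      ring)
  refine tendsto_nhds_unique hlim₂ (hlim₁.neg.congr fun n => ?_)
  rw [← h (φ n) (hsmooth n) (hcomp n) (htsupp n)]
  exact integral_congr_ae (ae_of_all _ fun x => by simp only [(hderiv n x).deriv])

lemma MemH.memLp_weakDeriv {m : ℕ} (h : MemH a b m f) (hj : j ≤ m) :
    MemLp (weakDeriv a b j f) 2 (volume.restrict (Ioo a b)) := by
  obtain ⟨g, hg, hw⟩ := h.2 j hj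
  exact hg.ae_eq hw.weakDeriv_ae_eq.symm

lemma MemH.hasWeakDeriv {m : ℕ} (h : MemH a b m f) (hj : j ≤ m) :
    HasWeakDeriv a b j f (weakDeriv a b j f) := by
  obtain ⟨g, hg, hw⟩ := h.2 j hj
  exact hw.hasWeakDeriv_weakDeriv

lemma HasWeakDeriv.hasPolyWeakDeriv {g' : ℝ → ℝ} (hab : a < b) (h : HasWeakDeriv a b j f g)
    (h' : HasWeakDeriv a b (j + 1) f g') (hg : IntegrableOn g (Ioo a b))
    (hg' : IntegrableOn g' (Ioo a b)) : HasPolyWeakDeriv a b g g' := by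
  refine hasPolyWeakDeriv_of_forall_test hab hg hg' fun φ hφ hc ht => ?_
  have h1 := h.2.2 (deriv φ) (contDiff_infty_iff_deriv.1 hφ).2 hc.deriv
    (tsupport_deriv_subset.trans ht)
  have h2 := h'.2.2 φ hφ hc ht
  rw [iteratedDeriv_succ', h1, pow_succ, mul_assoc] at h2
  have h3 := mul_left_cancel₀ (pow_ne_zero j (by norm_num : (-1 : ℝ) ≠ 0)) h2
  rw [h3]
  ring

end WeakDeriv

section Transfer

/-! ### Affine transfer to the reference interval -/

/-- The affine map from `(c - h, c + h)` to `(-1, 1)`, as a polynomial. -/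
def toRef (c h : ℝ) : ℝ[X] := C h⁻¹ * (X - C c)

lemma eval_toRef (c h x : ℝ) : (toRef c h).eval x = h⁻¹ * (x - c) := by simp [toRef]

lemma eval_toRef_add_mul (c : ℝ) {h : ℝ} (hh : h ≠ 0) (t : ℝ) :
    (toRef c h).eval (c + h * t) = t := by
  rw [eval_toRef]; field_simp; ring

lemma derivative_comp_toRef (c h : ℝ) (p : ℝ[X]) :
    derivative (p.comp (toRef c h)) = C h⁻¹ * (derivative p).comp (toRef c h) := by
  rw [derivative_comp]
  congr 1
  simp [toRef]

lemma iterate_derivative_comp_toRef (c h : ℝ) (p : ℝ[X]) (s : ℕ) :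
    derivative^[s] (p.comp (toRef c h)) =
      C ((h⁻¹) ^ s) * (derivative^[s] p).comp (toRef c h) := by
  induction s with
  | zero => simp
  | succ s ih =>
    rw [Function.iterate_succ_apply', ih, derivative_C_mul, derivative_comp_toRef,
      Function.iterate_succ_apply', ← mul_assoc, ← C_mul, pow_succ]

lemma setIntegral_eq_mul_setIntegral_ref (c : ℝ) {h : ℝ} (hh : 0 < h) (g : ℝ → ℝ) :
    ∫ x in Ioo (c - h) (c + h), g x = h * ∫ t in Ioo (-1 : ℝ) 1, g (c + h * t) := by
  rw [setIntegral_Ioo_eq (by linarith), setIntegral_Ioo_eq (by norm_num),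
    intervalIntegral.integral_comp_add_mul g hh.ne', smul_eq_mul, mul_inv_cancel_left₀ hh.ne']
  congr 1 <;> ring

lemma normL2_sq_eq_mul_ref (c : ℝ) {h : ℝ} (hh : 0 < h) (g : ℝ → ℝ) :
    normL2 (c - h) (c + h) g ^ 2 = h * normL2 (-1) 1 (fun t => g (c + h * t)) ^ 2 := by
  rw [normL2_sq, normL2_sq, setIntegral_eq_mul_setIntegral_ref c hh]

lemma integrable_comp_ref {c h : ℝ} (hh : 0 < h) {g : ℝ → ℝ}
    (hg : IntegrableOn g (Ioo (c - h) (c + h))) :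
    IntegrableOn (fun t => g (c + h * t)) (Ioo (-1 : ℝ) 1) := by
  rw [← intervalIntegrable_iff_integrableOn_Ioo_of_le (by linarith)] at hg
  rw [← intervalIntegrable_iff_integrableOn_Ioo_of_le (by norm_num)]
  have h1 := (hg.comp_add_left c).comp_mul_left (c := h)
  convert! h1 using 1 <;> field_simp <;> ring

lemma memLp_comp_ref {c h : ℝ} (hh : 0 < h) {g : ℝ → ℝ}
    (hg : MemLp g 2 (volume.restrict (Ioo (c - h) (c + h)))) :
    MemLp (fun t => g (c + h * t)) 2 (volume.restrict (Ioo (-1 : ℝ) 1)) := by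
  have h1 := integrable_comp_ref hh (hg.integrable one_le_two)
  exact (memLp_two_iff_integrable_sq h1.aestronglyMeasurable).2
    (integrable_comp_ref hh hg.integrable_sq)

lemma HasPolyWeakDeriv.ref {c h : ℝ} (hh : 0 < h) {u v : ℝ → ℝ}
    (huv : HasPolyWeakDeriv (c - h) (c + h) u v) :
    HasPolyWeakDeriv (-1) 1 (fun t => u (c + h * t)) fun t => h * v (c + h * t) := by
  intro Q hQ1 hQ2
  have e1 : (toRef c h).eval (c - h) = -1 := by rw [eval_toRef]; field_simp; ring
  have e2 : (toRef c h).eval (c + h) = 1 := by rw [eval_toRef]; field_simp; ring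
  have h1 := huv (Q.comp (toRef c h)) (by rw [eval_comp, e1, hQ1]) (by rw [eval_comp, e2, hQ2])
  rw [setIntegral_eq_mul_setIntegral_ref c hh, setIntegral_eq_mul_setIntegral_ref c hh] at h1
  simp only [derivative_comp_toRef, eval_mul, eval_C, eval_comp, eval_toRef_add_mul c hh.ne',
    mul_left_comm _ h⁻¹] at h1
  rw [integral_const_mul, mul_inv_cancel_left₀ hh.ne'] at h1
  rw [h1]
  simp only [mul_assoc, integral_const_mul]

/-- `F 0, …, F m` are the weak derivatives of `f` on `(a, b)`, all square integrable. -/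
structure IsWeakDerivFamily (a b : ℝ) (m : ℕ) (f : ℝ → ℝ) (F : ℕ → ℝ → ℝ) : Prop where
  zero : F 0 = f
  memLp : ∀ j ≤ m, MemLp (F j) 2 (volume.restrict (Ioo a b))
  hasWeakDeriv : ∀ j ≤ m, HasWeakDeriv a b j f (F j)

variable {a b : ℝ} {m : ℕ} {f : ℝ → ℝ} {F : ℕ → ℝ → ℝ}

lemma MemH.exists_isWeakDerivFamily (hf : MemH a b m f) :
    ∃ F, IsWeakDerivFamily a b m f F ∧ ∀ j ≤ m, normL2 a b (weakDeriv a b j f) = normL2 a b (F j) := by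
  have hloc : LocallyIntegrableOn f (Ioo a b) := (hf.2 0 (Nat.zero_le m)).choose_spec.2.1
  have h0 : HasWeakDeriv a b 0 f f := ⟨hloc, hloc, fun φ _ _ _ => by simp⟩
  -- The chosen weak derivative of order `0` agrees with `f` only almost everywhere; taking `f`
  -- itself gives the exact equality `F 0 = f`.
  refine ⟨fun j => if j = 0 then f else weakDeriv a b j f, ⟨if_pos rfl, fun j hj => ?_,
    fun j hj => ?_⟩, fun j hj => ?_⟩
  · split_ifs
    · exact hf.1
    · exact hf.memLp_weakDeriv hj
  · split_ifs with hj0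
    · exact hj0 ▸ h0
    · exact hf.hasWeakDeriv hj
  · dsimp only
    split_ifs with hj0
    · exact normL2_congr (hj0 ▸ h0.weakDeriv_ae_eq)
    · rfl

lemma IsWeakDerivFamily.mono {c d : ℝ} (h : IsWeakDerivFamily a b m f F)
    (hs : Ioo c d ⊆ Ioo a b) : IsWeakDerivFamily c d m f F :=
  ⟨h.zero, fun j hj => (h.memLp j hj).mono_measure (Measure.restrict_mono hs le_rfl),
    fun j hj => (h.hasWeakDeriv j hj).mono hs⟩

/-- The pull-back of the derivatives of a function on `(c - h, c + h)` to `(-1, 1)`. -/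
def refFamily (c h : ℝ) (F : ℕ → ℝ → ℝ) (j : ℕ) (t : ℝ) : ℝ := h ^ j * F j (c + h * t)

lemma IsWeakDerivFamily.isDerivChain_refFamily {c h : ℝ} (hh : 0 < h)
    (hF : IsWeakDerivFamily (c - h) (c + h) m f F) : IsDerivChain m (refFamily c h F) := by
  refine ⟨fun j hj => (memLp_comp_ref hh (hF.memLp j hj)).const_mul (h ^ j), fun j hj => ?_⟩
  have h1 := ((hF.hasWeakDeriv j hj.le).hasPolyWeakDeriv (by linarith)
    (hF.hasWeakDeriv (j + 1) hj) ((hF.memLp j hj.le).integrable one_le_two)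
    ((hF.memLp (j + 1) hj).integrable one_le_two)).ref hh
  intro Q hQ1 hQ2
  have h2 := h1 Q hQ1 hQ2
  simp only [refFamily, mul_assoc, integral_const_mul, pow_succ] at h2 ⊢
  rw [h2]
  ring

lemma mul_normL2_refFamily_sq (c : ℝ) {h : ℝ} (hh : 0 < h) (F : ℕ → ℝ → ℝ) (j : ℕ) :
    h * normL2 (-1) 1 (refFamily c h F j) ^ 2 = (h ^ 2) ^ j * normL2 (c - h) (c + h) (F j) ^ 2 := by
  have e : normL2 (-1) 1 (refFamily c h F j) = |h ^ j| * normL2 (-1) 1 (fun t => F j (c + h * t)) :=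
    normL2_const_mul _ _ _ _
  rw [normL2_sq_eq_mul_ref c hh, e, mul_pow, sq_abs]
  ring

/-- The Legendre projection of `f` on `(c - h, c + h)`. -/
def cellProj (c h : ℝ) (M : ℕ) (f : ℝ → ℝ) : ℝ[X] :=
  (proj M fun t => f (c + h * t)).comp (toRef c h)

lemma mul_projErrorDeriv_refFamily_sq (c : ℝ) {h : ℝ} (hh : 0 < h) (hF : F 0 = f) (s M : ℕ) :
    h * projErrorDeriv s M (refFamily c h F) ^ 2 =
      (h ^ 2) ^ s * normL2 (c - h) (c + h)
        (fun x => F s x - (derivative^[s] (cellProj c h M f)).eval x) ^ 2 := by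
  have e0 : refFamily c h F 0 = fun t => f (c + h * t) := by
    ext t; simp [refFamily, hF]
  have e : ∀ t, refFamily c h F s t - (derivative^[s] (proj M (refFamily c h F 0))).eval t =
      h ^ s * (F s (c + h * t) - (derivative^[s] (cellProj c h M f)).eval (c + h * t)) := by
    intro t
    rw [cellProj, iterate_derivative_comp_toRef, eval_mul, eval_comp, eval_toRef_add_mul c hh.ne',
      eval_C, e0, mul_sub, ← mul_assoc, ← mul_pow, mul_inv_cancel₀ hh.ne', one_pow, one_mul,
      refFamily]
  rw [projErrorDeriv, normL2_sq_eq_mul_ref c hh]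
  simp only [e]
  rw [normL2_const_mul, mul_pow, sq_abs]
  ring

/-! ### The wavelet expansion on a mesh interval -/

/-- Half the length of the mesh intervals of level `k`. -/
def cellHalf (l : ℝ) (k : ℕ) : ℝ := l / 2 ^ k

/-- The midpoint of the `n`-th mesh interval of level `k`. -/
def cellMid (l : ℝ) (k n : ℕ) : ℝ := (2 * n - 1) * cellHalf l k

variable {l : ℝ} {k n : ℕ}

lemma cellHalf_pos (hl : 0 < l) (k : ℕ) : 0 < cellHalf l k := by unfold cellHalf; positivity

lemma node_eq (hk : 1 ≤ k) (n : ℕ) : node l k n = cellMid l k n + cellHalf l k := by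
  obtain ⟨k, rfl⟩ : ∃ j, k = j + 1 := ⟨k - 1, by omega⟩
  rw [node, cellMid, cellHalf, Nat.add_sub_cancel, pow_succ]
  field_simp
  ring

lemma node_pred_eq (hk : 1 ≤ k) (hn : 1 ≤ n) :
    node l k (n - 1) = cellMid l k n - cellHalf l k := by
  rw [node_eq hk, cellMid, cellMid, Nat.cast_sub hn]
  push_cast
  ring

lemma node_mono (hl : 0 < l) {p q : ℕ} (h : p ≤ q) : node l k p ≤ node l k q := by
  unfold node
  gcongr

@[simp]
lemma node_zero : node l k 0 = 0 := by simp [node]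

lemma node_last : node l k (2 ^ (k - 1)) = l := by simp [node]

lemma Ico_node_subset (hl : 0 < l) (hn : n ∈ Finset.Icc 1 (2 ^ (k - 1))) :
    Ico (node l k (n - 1)) (node l k n) ⊆ Ico 0 l := by
  refine Ico_subset_Ico ?_ ?_
  · rw [← node_zero (l := l) (k := k)]; exact node_mono hl (Nat.zero_le _)
  · exact (node_mono hl (Finset.mem_Icc.1 hn).2).trans_eq node_last

lemma Ioo_node_subset (hl : 0 < l) (hn : n ∈ Finset.Icc 1 (2 ^ (k - 1))) :
    Ioo (node l k (n - 1)) (node l k n) ⊆ Ioo 0 l := by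
  refine Ioo_subset_Ioo ?_ ?_
  · rw [← node_zero (l := l) (k := k)]; exact node_mono hl (Nat.zero_le _)
  · exact (node_mono hl (Finset.mem_Icc.1 hn).2).trans_eq node_last

/-- The normalization constant of the wavelets. -/
def waveletScale (l : ℝ) (k i : ℕ) : ℝ :=
  (2 : ℝ) ^ ((k : ℝ) / 2) * Real.sqrt ((2 * (i : ℝ) + 1) / (2 * l))

lemma waveletScale_sq (hl : 0 < l) (i : ℕ) :
    waveletScale l k i ^ 2 * cellHalf l k = (2 * i + 1) / 2 := by
  have h1 : ((2 : ℝ) ^ ((k : ℝ) / 2)) ^ 2 = 2 ^ k := by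
    rw [← Real.rpow_natCast, ← Real.rpow_mul (by norm_num)]
    norm_num
  rw [waveletScale, mul_pow, h1, Real.sq_sqrt (by positivity), cellHalf]
  field_simp

lemma wavelet_eq (hl : 0 < l) (n i : ℕ) (x : ℝ) :
    wavelet l k n i x = (Ico (node l k (n - 1)) (node l k n)).indicator
      (fun x => waveletScale l k i * (legendre i).eval ((toRef (cellMid l k n) (cellHalf l k)).eval x))
      x := by
  have e : ∀ x, (2 : ℝ) ^ k / l * x - 2 * n + 1 =
      (toRef (cellMid l k n) (cellHalf l k)).eval x := by
    intro x
    rw [eval_toRef, cellMid, cellHalf]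
    field_simp
    ring
  simp only [wavelet, e, waveletScale]

lemma wavelet_eq_zero_of_ne (hl : 0 < l) {n' i : ℕ} (hn : 1 ≤ n) (hn' : 1 ≤ n') (h : n' ≠ n) {x : ℝ}
    (hx : x ∈ Ico (node l k (n - 1)) (node l k n)) : wavelet l k n' i x = 0 := by
  refine indicator_of_notMem (fun hx' => ?_) _
  rcases lt_or_gt_of_ne h with h | h
  · have := node_mono (k := k) hl (show n' ≤ n - 1 by omega)
    linarith [hx.1, hx'.2]
  · have := node_mono (k := k) hl (show n ≤ n' - 1 by omega)
    linarith [hx.2, hx'.1]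

lemma coeff_eq (hl : 0 < l) (hk : 1 ≤ k) (hn : n ∈ Finset.Icc 1 (2 ^ (k - 1))) (f : ℝ → ℝ)
    (i : ℕ) :
    coeff l k f n i = waveletScale l k i * cellHalf l k *
      moment (fun t => f (cellMid l k n + cellHalf l k * t)) i := by
  have hh := cellHalf_pos hl k
  have hn1 := (Finset.mem_Icc.1 hn).1
  simp only [coeff, wavelet_eq hl, ← indicator_mul_right]
  -- Wavelets live on half-open cells and integrals on open ones; the endpoints are null.
  rw [← integral_Ico_eq_integral_Ioo, setIntegral_indicator measurableSet_Ico,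
    inter_eq_self_of_subset_right (Ico_node_subset hl hn), integral_Ico_eq_integral_Ioo,
    node_pred_eq hk hn1, node_eq hk, setIntegral_eq_mul_setIntegral_ref _ hh]
  simp only [eval_toRef_add_mul _ hh.ne', mul_left_comm _ (waveletScale l k i)]
  rw [integral_const_mul, moment]
  ring

/-- Wavelets of other cells vanish here, and the two normalization factors, one in the coefficient
and one in the wavelet, combine with the Jacobian to the Legendre weight `(2i+1)/2`. -/
lemma Psi_eq (hl : 0 < l) (hk : 1 ≤ k) (hn : n ∈ Finset.Icc 1 (2 ^ (k - 1))) (M : ℕ) (f : ℝ → ℝ)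
    {x : ℝ} (hx : x ∈ Ico (node l k (n - 1)) (node l k n)) :
    Psi l k M f x = (cellProj (cellMid l k n) (cellHalf l k) M f).eval x := by
  rw [Psi, Finset.sum_eq_single_of_mem n hn]
  · rw [cellProj, proj, eval_comp, eval_finsetSum]
    refine Finset.sum_congr rfl fun i _ => ?_
    rw [coeff_eq hl hk hn, wavelet_eq hl, indicator_of_mem hx, eval_mul, eval_C,
      ← waveletScale_sq (k := k) hl i]
    ring
  · intro n' hn' hne
    refine Finset.sum_eq_zero fun i _ => ?_
    rw [wavelet_eq_zero_of_ne hl (Finset.mem_Icc.1 hn).1 (Finset.mem_Icc.1 hn').1 hne hx, mul_zero]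

lemma memLp_Psi (hl : 0 < l) (M : ℕ) (f : ℝ → ℝ) (a b : ℝ) :
    MemLp (Psi l k M f) 2 (volume.restrict (Ioo a b)) := by
  unfold Psi
  refine memLp_finsetSum _ fun n _ => memLp_finsetSum _ fun i _ => MemLp.const_mul ?_ _
  simp only [funext (wavelet_eq (k := k) hl n i)]
  refine MemLp.indicator measurableSet_Ico (memLp_two_of_continuous ?_ a b)
  fun_prop

lemma sum_setIntegral_node (hl : 0 < l) {g : ℝ → ℝ} (hg : IntegrableOn g (Ioo 0 l)) :
    ∑ n ∈ Finset.Icc 1 (2 ^ (k - 1)), ∫ x in Ioo (node l k (n - 1)) (node l k n), g x =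
      ∫ x in Ioo 0 l, g x := by
  have hi : ∀ n < 2 ^ (k - 1), IntervalIntegrable g volume (node l k n) (node l k (n + 1)) := by
    intro n hn
    rw [intervalIntegrable_iff_integrableOn_Ioo_of_le (node_mono hl (Nat.le_succ n))]
    exact hg.mono_set (Ioo_node_subset hl (n := n + 1) (Finset.mem_Icc.2 ⟨by omega, hn⟩))
  have h := intervalIntegral.sum_integral_adjacent_intervals hi
  rw [node_zero, node_last, ← setIntegral_Ioo_eq hl.le] at h
  rw [← h, Finset.range_eq_Ico, ← Finset.Ico_add_one_right_eq_Icc,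
    ← Finset.sum_Ico_add' _ 0 (2 ^ (k - 1)) 1]
  refine Finset.sum_congr rfl fun n _ => ?_
  rw [Nat.add_sub_cancel, setIntegral_Ioo_eq (node_mono hl (Nat.le_succ n))]

lemma sum_normL2_node_sq (hl : 0 < l) {g : ℝ → ℝ} (hg : MemLp g 2 (volume.restrict (Ioo 0 l))) :
    ∑ n ∈ Finset.Icc 1 (2 ^ (k - 1)), normL2 (node l k (n - 1)) (node l k n) g ^ 2 =
      normL2 0 l g ^ 2 := by
  simp only [normL2_sq]
  exact sum_setIntegral_node hl hg.integrable_sq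

/-- The weak derivatives of the approximation error on a mesh interval. -/
lemma hasWeakDeriv_sub_Psi (hl : 0 < l) (hk : 1 ≤ k) (hn : n ∈ Finset.Icc 1 (2 ^ (k - 1))) (M : ℕ)
    (hF : IsWeakDerivFamily 0 l m f F) {s : ℕ} (hs : s ≤ m) :
    HasWeakDeriv (node l k (n - 1)) (node l k n) s (fun x => f x - Psi l k M f x)
      fun x => F s x - (derivative^[s] (cellProj (cellMid l k n) (cellHalf l k) M f)).eval x := by
  refine (((hF.hasWeakDeriv s hs).mono (Ioo_node_subset hl hn)).sub
    (hasWeakDeriv_eval (node_mono hl (Nat.sub_le n 1)) _ s)).congr fun x hx => ?_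
  simp only [Psi_eq hl hk hn M f (Ioo_subset_Ico_self hx)]

lemma memH_sub_Psi (hl : 0 < l) (hk : 1 ≤ k) (hn : n ∈ Finset.Icc 1 (2 ^ (k - 1))) (M : ℕ)
    (hF : IsWeakDerivFamily 0 l m f F) {r : ℕ} (hr : r ≤ m) :
    MemH (node l k (n - 1)) (node l k n) r (fun x => f x - Psi l k M f x) := by
  have hF' := hF.mono (Ioo_node_subset hl hn)
  refine ⟨?_, fun s hs => ⟨_, ?_, hasWeakDeriv_sub_Psi hl hk hn M hF (hs.trans hr)⟩⟩
  · exact (hF.zero ▸ hF'.memLp 0 (Nat.zero_le m)).sub (memLp_Psi hl M f _ _)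
  · exact (hF'.memLp s (hs.trans hr)).sub (memLp_two_eval _ _ _)

end Transfer

section Estimates

/-! ### Error estimates -/

lemma exists_reference_bound (m : ℕ) :
    ∃ K : ℝ, 0 < K ∧ ∀ u : ℕ → ℝ → ℝ, IsDerivChain m u → ∀ M : ℕ,
      ((M : ℝ) + 1) ^ (2 * m) * projErrorDeriv 0 M u ^ 2 ≤
        K * normL2 (-1) 1 (u (min m M)) ^ 2 ∧
      ∀ s, 1 ≤ s → s ≤ m → ((M : ℝ) + 1) ^ (2 * m + 1) * projErrorDeriv s M u ^ 2 ≤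
        K * ((M : ℝ) + 1) ^ (4 * s) * tailNormSq m M u := by
  obtain ⟨L, hL, h0⟩ := exists_projError_le m
  have h1 : ∀ s, ∃ K : ℝ, 0 < K ∧ (1 ≤ s → s ≤ m → ∀ u : ℕ → ℝ → ℝ, IsDerivChain m u → ∀ M : ℕ,
      ((M : ℝ) + 1) ^ (2 * m + 1) * projErrorDeriv s M u ^ 2 ≤
        K * ((M : ℝ) + 1) ^ (4 * s) * tailNormSq m M u) := by
    intro s
    by_cases hs : 1 ≤ s ∧ s ≤ m
    · obtain ⟨K, hK, h⟩ := exists_projErrorDeriv_le hs.1 hs.2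
      exact ⟨K, hK, fun _ _ => h⟩
    -- A dummy constant for orders out of range lets a choice function be summed into one constant
    -- valid for all `s`.
    · exact ⟨1, one_pos, fun a b => absurd ⟨a, b⟩ hs⟩
  choose K hK h1 using h1
  have hS : 0 ≤ ∑ s ∈ Finset.range (m + 1), K s := Finset.sum_nonneg fun s _ => (hK s).le
  refine ⟨L + ∑ s ∈ Finset.range (m + 1), K s, by positivity, fun u hu M => ⟨?_, ?_⟩⟩
  · refine (h0 u hu M).trans ?_
    gcongr
    linarith
  · intro s hs hsm
    have h2 : K s ≤ ∑ s ∈ Finset.range (m + 1), K s :=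
      Finset.single_le_sum (fun i _ => (hK i).le) (Finset.mem_range.2 (by omega))
    have h3 := tailNormSq_nonneg m M u
    refine (h1 s hs hsm u hu M).trans ?_
    gcongr
    linarith

variable {l : ℝ} {k m : ℕ} {f : ℝ → ℝ} {F : ℕ → ℝ → ℝ}

/-- The squared `L²` norm of the piecewise `s`-th derivative of the approximation error. -/
def meshError (l : ℝ) (k M : ℕ) (f : ℝ → ℝ) (F : ℕ → ℝ → ℝ) (s : ℕ) : ℝ :=
  ∑ n ∈ Finset.Icc 1 (2 ^ (k - 1)), normL2 (node l k (n - 1)) (node l k n)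
    (fun x => F s x - (derivative^[s] (cellProj (cellMid l k n) (cellHalf l k) M f)).eval x) ^ 2

lemma normL2_sub_Psi_sq (hl : 0 < l) (hk : 1 ≤ k) (M : ℕ) (hF : IsWeakDerivFamily 0 l m f F) :
    normL2 0 l (fun x => f x - Psi l k M f x) ^ 2 = meshError l k M f F 0 := by
  have h : MemLp (fun x => f x - Psi l k M f x) 2 (volume.restrict (Ioo 0 l)) :=
    (hF.zero ▸ hF.memLp 0 (Nat.zero_le m)).sub (memLp_Psi hl M f _ _)
  rw [← sum_normL2_node_sq (k := k) hl h, meshError]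
  refine Finset.sum_congr rfl fun n hn => congrArg (· ^ 2) (normL2_congr ?_)
  filter_upwards [ae_restrict_mem measurableSet_Ioo] with x hx
  rw [Psi_eq hl hk hn M f (Ioo_subset_Ico_self hx), hF.zero, Function.iterate_zero_apply]

lemma brokenNormH_sub_Psi_sq (hl : 0 < l) (hk : 1 ≤ k) (M : ℕ) (hF : IsWeakDerivFamily 0 l m f F)
    {r : ℕ} (hr : r ≤ m) :
    brokenNormH l k r (fun x => f x - Psi l k M f x) ^ 2 =
      ∑ s ∈ Finset.range (r + 1), meshError l k M f F s := by
  rw [brokenNormH, Real.sq_sqrt (Finset.sum_nonneg fun _ _ => sq_nonneg _)]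
  simp only [meshError]
  rw [Finset.sum_comm]
  refine Finset.sum_congr rfl fun n hn => ?_
  rw [normH, Real.sq_sqrt (Finset.sum_nonneg fun _ _ => sq_nonneg _)]
  refine Finset.sum_congr rfl fun s hs => congrArg (· ^ 2) (normL2_congr ?_)
  exact (hasWeakDeriv_sub_Psi hl hk hn M hF
    (by have := Finset.mem_range.1 hs; omega)).weakDeriv_ae_eq

/-- The scaled estimates on all mesh intervals, summed up. -/
lemma meshError_le (hl : 0 < l) (hk : 1 ≤ k) (M : ℕ) (hF : IsWeakDerivFamily 0 l m f F) {K : ℝ}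
    (hK : ∀ u : ℕ → ℝ → ℝ, IsDerivChain m u → ∀ M : ℕ,
      ((M : ℝ) + 1) ^ (2 * m) * projErrorDeriv 0 M u ^ 2 ≤
        K * normL2 (-1) 1 (u (min m M)) ^ 2 ∧
      ∀ s, 1 ≤ s → s ≤ m → ((M : ℝ) + 1) ^ (2 * m + 1) * projErrorDeriv s M u ^ 2 ≤
        K * ((M : ℝ) + 1) ^ (4 * s) * tailNormSq m M u) :
    ((M : ℝ) + 1) ^ (2 * m) * meshError l k M f F 0 ≤
        K * ((cellHalf l k ^ 2) ^ (min m M) * normL2 0 l (F (min m M)) ^ 2) ∧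
      ∀ s, 1 ≤ s → s ≤ m →
        ((M : ℝ) + 1) ^ (2 * m + 1) * ((cellHalf l k ^ 2) ^ s * meshError l k M f F s) ≤
          K * ((M : ℝ) + 1) ^ (4 * s) * ∑ j ∈ Finset.Icc (min m M) m,
            (cellHalf l k ^ 2) ^ j * normL2 0 l (F j) ^ 2 := by
  have hh := cellHalf_pos hl k
  have hchain : ∀ n ∈ Finset.Icc 1 (2 ^ (k - 1)),
      IsDerivChain m (refFamily (cellMid l k n) (cellHalf l k) F) := by
    intro n hn
    have h1 := hF.mono (Ioo_node_subset hl hn)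
    rw [node_pred_eq hk (Finset.mem_Icc.1 hn).1, node_eq hk] at h1
    exact h1.isDerivChain_refFamily hh
  have hnorm : ∀ n ∈ Finset.Icc 1 (2 ^ (k - 1)), ∀ j,
      (cellHalf l k ^ 2) ^ j * normL2 (node l k (n - 1)) (node l k n) (F j) ^ 2 =
        cellHalf l k * normL2 (-1) 1 (refFamily (cellMid l k n) (cellHalf l k) F j) ^ 2 := by
    intro n hn j
    rw [node_pred_eq hk (Finset.mem_Icc.1 hn).1, node_eq hk, mul_normL2_refFamily_sq _ hh]
  have herr : ∀ n ∈ Finset.Icc 1 (2 ^ (k - 1)), ∀ s,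
      (cellHalf l k ^ 2) ^ s * normL2 (node l k (n - 1)) (node l k n) (fun x => F s x -
        (derivative^[s] (cellProj (cellMid l k n) (cellHalf l k) M f)).eval x) ^ 2 =
        cellHalf l k * projErrorDeriv s M (refFamily (cellMid l k n) (cellHalf l k) F) ^ 2 := by
    intro n hn s
    rw [node_pred_eq hk (Finset.mem_Icc.1 hn).1, node_eq hk,
      mul_projErrorDeriv_refFamily_sq _ hh hF.zero]
  constructor
  · rw [meshError, ← sum_normL2_node_sq (k := k) hl (hF.memLp _ (min_le_left m M)),
      Finset.mul_sum, Finset.mul_sum, Finset.mul_sum]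
    refine Finset.sum_le_sum fun n hn => ?_
    have h1 := herr n hn 0
    rw [pow_zero, one_mul] at h1
    rw [h1, hnorm n hn, mul_left_comm, mul_left_comm K]
    exact mul_le_mul_of_nonneg_left (hK _ (hchain n hn) M).1 hh.le
  · intro s hs hsm
    -- All cells have the same half-length, so the scaling factors are independent of `n` and the
    -- local seminorms sum to the global one.
    have e : ∑ j ∈ Finset.Icc (min m M) m, (cellHalf l k ^ 2) ^ j * normL2 0 l (F j) ^ 2 =
        ∑ n ∈ Finset.Icc 1 (2 ^ (k - 1)), cellHalf l k *
          tailNormSq m M (refFamily (cellMid l k n) (cellHalf l k) F) := by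
      simp only [tailNormSq, Finset.mul_sum]
      rw [Finset.sum_comm]
      refine Finset.sum_congr rfl fun j hj => ?_
      rw [← sum_normL2_node_sq (k := k) hl (hF.memLp j (Finset.mem_Icc.1 hj).2), Finset.mul_sum]
      exact Finset.sum_congr rfl fun n hn => hnorm n hn j
    rw [e, meshError, Finset.mul_sum, Finset.mul_sum, Finset.mul_sum]
    refine Finset.sum_le_sum fun n hn => ?_
    rw [herr n hn, mul_left_comm, mul_left_comm (K * _)]
    exact mul_le_mul_of_nonneg_left ((hK _ (hchain n hn) M).2 s hs hsm) hh.le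

/-- The constant that absorbs the powers of `l`. -/
def scaleConst (l : ℝ) (m : ℕ) : ℝ := ((1 + l) * (1 + l⁻¹)) ^ (2 * m)

lemma scaleConst_pos (hl : 0 < l) (m : ℕ) : 0 < scaleConst l m := by
  unfold scaleConst; positivity

/-- Raising the power of `2^k` from `2s` to `2r` only enlarges the right side. The sign of `j - s`
and the size of `l` relative to `1` are arbitrary, so `1 + l` absorbs `l^{2j}` and `1 + l⁻¹` absorbs
`l^{-2s}`. -/
lemma cellHalf_sq_pow_le (hl : 0 < l) {r s j : ℕ} (hs : s ≤ r) (hr : r ≤ m) (hj : j ≤ m) :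
    (cellHalf l k ^ 2) ^ j ≤ (cellHalf l k ^ 2) ^ s *
      (scaleConst l m * ((2 : ℝ) ^ k) ^ (2 * (r : ℤ) - 2 * (j : ℤ))) := by
  have h1 : l ^ (2 * j) ≤ (1 + l) ^ (2 * m) :=
    (pow_le_pow_left₀ hl.le (by linarith) _).trans
      (pow_le_pow_right₀ (by linarith) (by omega))
  have h2 : 1 ≤ l ^ (2 * s) * (1 + l⁻¹) ^ (2 * m) := by
    calc (1 : ℝ) ≤ (l * (1 + l⁻¹)) ^ (2 * s) := by
          refine one_le_pow₀ ?_
          rw [mul_add, mul_inv_cancel₀ hl.ne']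
          linarith
      _ = l ^ (2 * s) * (1 + l⁻¹) ^ (2 * s) := mul_pow _ _ _
      _ ≤ _ := by
          gcongr
          · linarith [inv_pos.2 hl]
          · omega
  have hD : (1 : ℝ) ≤ 2 ^ k := one_le_pow₀ (by norm_num)
  rw [scaleConst, cellHalf]
  generalize (2 : ℝ) ^ k = D at hD
  have hD0 : 0 < D := by linarith
  have e1 : D ^ (2 * (r : ℤ) - 2 * (j : ℤ)) = D ^ (2 * r) / D ^ (2 * j) := by
    rw [zpow_sub₀ hD0.ne']
    norm_cast
  have e2 : ((l / D) ^ 2) ^ s * (((1 + l) * (1 + l⁻¹)) ^ (2 * m) * (D ^ (2 * r) / D ^ (2 * j))) =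
      ((1 + l) ^ (2 * m) * (l ^ (2 * s) * (1 + l⁻¹) ^ (2 * m)) * (D ^ (2 * r) / D ^ (2 * s))) /
        D ^ (2 * j) := by
    rw [← pow_mul, div_pow, mul_pow (1 + l)]
    ring
  have h3 : 1 ≤ D ^ (2 * r) / D ^ (2 * s) := by
    rw [one_le_div (by positivity)]
    exact pow_le_pow_right₀ hD (by omega)
  rw [e1, e2, ← pow_mul, div_pow]
  gcongr
  calc l ^ (2 * j) ≤ (1 + l) ^ (2 * m) * 1 * 1 := by linarith
    _ ≤ _ := by gcongr

lemma seminormH_sq (hN : ∀ j ≤ m, normL2 0 l (weakDeriv 0 l j f) = normL2 0 l (F j)) (r M k : ℕ) :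
    seminormH l r m M k f ^ 2 = ∑ j ∈ Finset.Icc (min m M) m,
      ((2 : ℝ) ^ k) ^ (2 * (r : ℤ) - 2 * (j : ℤ)) * normL2 0 l (F j) ^ 2 := by
  rw [seminormH, Real.sq_sqrt (Finset.sum_nonneg fun _ _ => by positivity)]
  exact Finset.sum_congr rfl fun j hj => by rw [hN j (Finset.mem_Icc.1 hj).2]

/-- Squared estimates have natural exponents; half-integer ones appear only on taking this square
root. -/
lemma le_of_pow_mul_sq_le {z B S K : ℝ} {p q : ℕ} {e : ℝ} (hz : 0 < z) (hK : 0 ≤ K)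
    (hS : 0 ≤ S) (he : 2 * e = (q : ℝ) - p) (h : z ^ p * B ^ 2 ≤ K * z ^ q * S ^ 2) :
    B ≤ Real.sqrt K * z ^ e * S := by
  have hze : (z ^ e) ^ 2 * z ^ p = z ^ q := by
    rw [← Real.rpow_natCast, ← Real.rpow_natCast z p, ← Real.rpow_natCast z q,
      ← Real.rpow_mul hz.le, ← Real.rpow_add hz]
    congr 1
    push_cast
    linarith
  refine le_of_sq_le_sq ?_ (by positivity)
  rw [mul_pow, mul_pow, Real.sq_sqrt hK]
  refine le_of_mul_le_mul_left (h.trans_eq ?_) (pow_pos hz p)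
  rw [← hze]
  ring

end Estimates

end LegendreWavelet

end

/-! ### Assembly of the two estimates with a common constant -/

open LegendreWavelet

theorem mainTheorem1 (l : ℝ) (hl : 0 < l) (m : ℕ) (hm : 1 ≤ m) :
    ∃ C : ℝ, 0 < C ∧
      ∀ f : ℝ → ℝ, LegendreWavelet.MemH 0 l m f →
        ∀ M k : ℕ, 2 ≤ M → 1 ≤ k →
          (MeasureTheory.MemLp (fun x => f x - LegendreWavelet.Psi l k M f x) 2
              (MeasureTheory.volume.restrict (Set.Ioo 0 l)) ∧
            LegendreWavelet.normL2 0 l (fun x => f x - LegendreWavelet.Psi l k M f x) ≤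
              C * ((M : ℝ) - 1) ^ (-(m : ℝ)) * LegendreWavelet.seminormH l 0 m M k f) ∧
          ∀ r : ℕ, 1 ≤ r → r ≤ m →
            LegendreWavelet.MemBrokenH l k r (fun x => f x - LegendreWavelet.Psi l k M f x) ∧
            LegendreWavelet.brokenNormH l k r (fun x => f x - LegendreWavelet.Psi l k M f x) ≤
              C * ((M : ℝ) - 1) ^ (2 * (r : ℝ) - 1 / 2 - (m : ℝ)) *
                LegendreWavelet.seminormH l r m M k f := by
  obtain ⟨K, hK, hbound⟩ := exists_reference_bound m
  have hΛ := scaleConst_pos hl m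
  set A : ℝ := K * scaleConst l m with hA
  have hA0 : 0 < A := mul_pos hK hΛ
  have hA1 : A ≤ (m + 1) * A * 3 ^ (4 * m) := by
    have h3 : (1 : ℝ) ≤ 3 ^ (4 * m) := one_le_pow₀ (by norm_num)
    have hm0 : (0 : ℝ) ≤ m := Nat.cast_nonneg m
    calc A = 1 * A * 1 := by ring
      _ ≤ _ := by gcongr; linarith
  -- The factor `m + 1` bounds the number of orders `s ≤ r`; `3 ^ (4 * m)` pays for replacing `M +
  -- 1` by `M - 1` in the numerator, where `M ≥ 2` gives `M + 1 ≤ 3 (M - 1)`.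
  refine ⟨Real.sqrt ((m + 1) * A * 3 ^ (4 * m)), Real.sqrt_pos.2 (by positivity),
    fun f hf M k hM hk => ?_⟩
  obtain ⟨F, hF, hN⟩ := hf.exists_isWeakDerivFamily
  obtain ⟨hE0, hE⟩ := meshError_le hl hk M hF hbound
  have hM2 : (2 : ℝ) ≤ M := by exact_mod_cast hM
  have hz1 : (1 : ℝ) ≤ (M : ℝ) - 1 := by linarith
  have hzy : (M : ℝ) - 1 ≤ (M : ℝ) + 1 := by linarith
  have hyz : (M : ℝ) + 1 ≤ 3 * ((M : ℝ) - 1) := by linarith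
  set z : ℝ := (M : ℝ) - 1
  set y : ℝ := (M : ℝ) + 1
  have hy1 : 1 ≤ y := hz1.trans hzy
  have hX : ∀ s, 0 ≤ meshError l k M f F s := fun s => Finset.sum_nonneg fun _ _ => sq_nonneg _
  have hX0 : ∀ r ≤ m, y ^ (2 * m) * meshError l k M f F 0 ≤ A * seminormH l r m M k f ^ 2 := by
    intro r hr
    rw [hA, seminormH_sq hN, mul_assoc]
    refine hE0.trans (mul_le_mul_of_nonneg_left ?_ hK.le)
    have h1 := cellHalf_sq_pow_le (k := k) hl (Nat.zero_le r) hr (min_le_left m M)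
    rw [pow_zero, one_mul] at h1
    refine (mul_le_mul_of_nonneg_right h1 (sq_nonneg _)).trans ?_
    rw [mul_assoc]
    gcongr
    exact Finset.single_le_sum
      (f := fun j : ℕ => ((2 : ℝ) ^ k) ^ (2 * (r : ℤ) - 2 * (j : ℤ)) * normL2 0 l (F j) ^ 2)
      (fun j _ => by positivity) (Finset.mem_Icc.2 ⟨le_rfl, min_le_left m M⟩)
  have hXs : ∀ r, 1 ≤ r → r ≤ m → ∀ s ≤ r,
      y ^ (2 * m + 1) * meshError l k M f F s ≤ A * y ^ (4 * r) * seminormH l r m M k f ^ 2 := by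
    intro r hr1 hr s hs
    -- The order `s = 0` has no half-power gain, but the missing factor `y` is at most `y ^ (4 * r)`
    -- because `r ≥ 1`.
    rcases Nat.eq_zero_or_pos s with rfl | hs0
    · calc y ^ (2 * m + 1) * meshError l k M f F 0
          = y ^ 1 * (y ^ (2 * m) * meshError l k M f F 0) := by ring
        _ ≤ y ^ (4 * r) * (A * seminormH l r m M k f ^ 2) :=
          mul_le_mul (pow_le_pow_right₀ hy1 (by omega)) (hX0 r hr)
            (mul_nonneg (by positivity) (hX 0)) (by positivity)
        _ = _ := by ring
    · have hh : 0 < (cellHalf l k ^ 2) ^ s := by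
        have := cellHalf_pos hl k
        positivity
      refine le_of_mul_le_mul_left ?_ hh
      calc (cellHalf l k ^ 2) ^ s * (y ^ (2 * m + 1) * meshError l k M f F s)
          = y ^ (2 * m + 1) * ((cellHalf l k ^ 2) ^ s * meshError l k M f F s) := by ring
        _ ≤ _ := hE s hs0 (hs.trans hr)
        _ ≤ K * y ^ (4 * r) * ∑ j ∈ Finset.Icc (min m M) m, (cellHalf l k ^ 2) ^ s *
            (scaleConst l m * ((2 : ℝ) ^ k) ^ (2 * (r : ℤ) - 2 * (j : ℤ))) *
              normL2 0 l (F j) ^ 2 := by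
          gcongr with j hj
          exact cellHalf_sq_pow_le hl hs hr (Finset.mem_Icc.1 hj).2
        _ = _ := by
          rw [seminormH_sq hN, hA]
          simp only [mul_assoc, ← Finset.mul_sum]
          ring
  have hS : ∀ r, 0 ≤ seminormH l r m M k f := fun r => Real.sqrt_nonneg _
  refine ⟨⟨(hF.zero ▸ hF.memLp 0 (Nat.zero_le m)).sub (memLp_Psi hl M f _ _), ?_⟩,
    fun r hr1 hr => ⟨fun n hn => memH_sub_Psi hl hk hn M hF hr, ?_⟩⟩
  · refine le_of_pow_mul_sq_le (p := 2 * m) (q := 0) (by linarith) (by positivity) (hS 0)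
      (by push_cast; ring) ?_
    rw [normL2_sub_Psi_sq hl hk M hF, pow_zero, mul_one]
    calc z ^ (2 * m) * meshError l k M f F 0 ≤ y ^ (2 * m) * meshError l k M f F 0 := by
          have := hX 0
          gcongr
      _ ≤ A * seminormH l 0 m M k f ^ 2 := hX0 0 (Nat.zero_le m)
      _ ≤ _ := by gcongr
  · refine le_of_pow_mul_sq_le (p := 2 * m + 1) (q := 4 * r) (by linarith) (by positivity) (hS r)
      (by push_cast; ring) ?_
    rw [brokenNormH_sub_Psi_sq hl hk M hF hr]
    calc z ^ (2 * m + 1) * ∑ s ∈ Finset.range (r + 1), meshError l k M f F s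
        ≤ y ^ (2 * m + 1) * ∑ s ∈ Finset.range (r + 1), meshError l k M f F s := by
          have := Finset.sum_nonneg fun s (_ : s ∈ Finset.range (r + 1)) => hX s
          gcongr
      _ ≤ ∑ s ∈ Finset.range (r + 1), A * y ^ (4 * r) * seminormH l r m M k f ^ 2 := by
          rw [Finset.mul_sum]
          exact Finset.sum_le_sum fun s hs =>
            hXs r hr1 hr s (Nat.lt_succ_iff.1 (Finset.mem_range.1 hs))
      _ = (r + 1) * A * y ^ (4 * r) * seminormH l r m M k f ^ 2 := by
          rw [Finset.sum_const, Finset.card_range, nsmul_eq_mul]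
          push_cast
          ring
      _ ≤ (m + 1) * A * (3 ^ (4 * m) * z ^ (4 * r)) * seminormH l r m M k f ^ 2 := by
          have h1 : y ^ (4 * r) ≤ 3 ^ (4 * m) * z ^ (4 * r) := by
            refine (pow_le_pow_left₀ (by linarith) hyz _).trans ?_
            rw [mul_pow]
            gcongr
            norm_num
          have h2 : (r : ℝ) ≤ m := by exact_mod_cast hr
          gcongr
      _ = _ := by ring
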